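/- Let $X$ be a (connected) tropical curve, i.e. the metric space obtained from a finite connected graph (loops and multiple edges allowed) by identifying every edge $e$ with a closed interval of length $\ell(e)>0$, and let $p_0\in X$ be a point. A divisor on $X$ is a function $\mathcal D\colon X\to\mathbb Z$ with finitely many nonzero values, and $\deg\mathcal D=\sum_{p\in X}\mathcal D(p)$. A rational function on $X$ is a continuous function $f\colon X\to\mathbb R$ that is piecewise linear with integer slopes on every edge; $\operatorname{ord}_p(f)$ is the sum of the incoming slopes of $f$ at $p$, and $\operatorname{div}(f)=\sum_p\operatorname{ord}_p(f)\,p$. Two divisors are equivalent if their difference is $\operatorname{div}(f)$ for some rational function $f$. Let $d\in\mathbb Z$ and let $\mu$ be a degree-$d$ polarization on $X$, i.e. a function $\mu\colon X\to\mathbb R$ with finitely many nonzero values such that $\sum_{p\in X}\mu(p)=d$. A tropical subcurve of $X$ is a (possibly empty or disconnected) subset $Y\subset X$ that meets every edge in a finite union of closed intervals, which may be single points; $\delta_Y$ denotes the sum over $p\in Y$ of the number of directions of $X$ at $p$ that leave $Y$. For a divisor $\mathcal D$ put $$\beta_{\mathcal D}(Y)=\sum_{p\in Y}\mathcal D(p)-\sum_{p\in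 Y}\mu(p)+\frac{\delta_Y}{2}.$$ The divisor $\mathcal D$ is $(p_0,\mu)$-quasistable if $\beta_{\mathcal D}(Y)\ge 0$ for every tropical subcurve $Y\subset X$ and $\beta_{\mathcal D}(Y)>0$ for every tropical subcurve $Y\subsetneq X$ with $p_0\in Y$. **Theorem.** For every divisor $\mathcal D$ of degree $d$ on $X$ there exists a unique divisor of degree $d$ on $X$ that is equivalent to $\mathcal D$ and $(p_0,\mu)$-quasistable. -/

import Mathlib

open Set Filter Topology

universe u v

set_option linter.checkUnivs false

noncomputable section

/-- A (connected) tropical curve, presented by a directed model `(Γ, ℓ)`: a finite connected graph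
`Γ`, loops and multiple edges allowed, with an (arbitrary) orientation `src`, `tgt` of its edges,
and a positive length for every edge. -/
structure TropicalCurve where
  V : Type u
  E : Type v
  finV : Finite V
  fintypeE : Fintype E
  src : E → V
  tgt : E → V
  len : E → ℝ
  len_pos : ∀ e, 0 < len e
  nonempty : Nonempty V
  connected : ∀ v w : V, Relation.EqvGen (fun a b => ∃ e, src e = a ∧ tgt e = b) v w

attribute [instance] TropicalCurve.finV TropicalCurve.fintypeE TropicalCurve.nonempty

namespace TropicalCurve

/-- The points of the tropical curve, i.e. of the quotient of `V ⊔ ⨆ₑ [0, ℓ(e)] × {e}` by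
`(0, e) ∼ src e` and `(ℓ(e), e) ∼ tgt e`: every class contains exactly one vertex, or exactly one
pair `(t, e)` with `0 < t < ℓ(e)`. -/
inductive Point (X : TropicalCurve.{u, v}) : Type (max u v)
  | vertex (w : X.V) : Point X
  | interior (e : X.E) (t : ℝ) (pos : 0 < t) (lt : t < X.len e) : Point X

variable (X : TropicalCurve.{u, v})

/-- The point on the edge `e` at distance `t` from its source, for `0 ≤ t ≤ ℓ(e)`. This is the
quotient map on `[0, ℓ(e)] × {e}`. Outside of `[0, ℓ(e)]` the value is that at the nearest end. -/
def pt (e : X.E) (t : ℝ) : X.Point :=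
  if h : 0 < t then
    if h' : t < X.len e then Point.interior e t h h' else Point.vertex (X.tgt e)
  else Point.vertex (X.src e)

/-- The quotient topology: a set is open if and only if its preimage in every closed edge
`[0, ℓ(e)]` is open. -/
instance : TopologicalSpace X.Point :=
  ⨆ e : X.E, TopologicalSpace.coinduced (fun t : Icc (0 : ℝ) (X.len e) => X.pt e t) inferInstance

/-! ### Divisors and linear equivalence -/

/-- Divisors on `X`: integer-valued functions on the points, zero at all but finitely many. -/
abbrev Divisor := X.Point →₀ ℤ

/-- The degree of a divisor. -/
def deg (D : X.Divisor) : ℤ := ∑ p ∈ D.support, D p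

/-- Rational functions: continuous functions whose restriction to every edge is piecewise linear
with integer slopes (the `t i` are the break points on the edge and the `m i` the slopes). -/
def IsRational (f : X.Point → ℝ) : Prop :=
  Continuous f ∧
  ∀ e : X.E, ∃ (n : ℕ) (t : ℕ → ℝ) (m : ℕ → ℤ), Monotone t ∧ t 0 = 0 ∧ t n = X.len e ∧
    ∀ i < n, ∀ s ∈ Icc (t i) (t (i + 1)),
      f (X.pt e s) = f (X.pt e (t i)) + m i * (s - t i)

/-- Slope of `f` on `e` just before the parameter `t`, in the direction of the edge. -/
def slopeBefore (f : X.Point → ℝ) (e : X.E) (t : ℝ) : ℝ :=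
  derivWithin (fun s => f (X.pt e s)) (Iio t) t

/-- Slope of `f` on `e` just after the parameter `t`, in the direction of the edge. -/
def slopeAfter (f : X.Point → ℝ) (e : X.E) (t : ℝ) : ℝ :=
  derivWithin (fun s => f (X.pt e s)) (Ioi t) t

/-- The order of `f` at `p`: the sum of the incoming slopes at `p`, over all the directions in
which an edge arrives at `p`. A segment of `e` that arrives at `p` from larger parameters is
travelled against the direction of `e`, whence the sign. A loop contributes both of its ends. -/
def ord (f : X.Point → ℝ) (p : X.Point) : ℝ :=
  ∑ e : X.E,
    ((∑ᶠ t ∈ {t : ℝ | t ∈ Ioc 0 (X.len e) ∧ X.pt e t = p}, X.slopeBefore f e t) -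
      ∑ᶠ t ∈ {t : ℝ | t ∈ Ico 0 (X.len e) ∧ X.pt e t = p}, X.slopeAfter f e t)

/-- Principal divisors: `D = div f` for a rational function `f`. -/
def IsPrincipal (D : X.Divisor) : Prop :=
  ∃ f : X.Point → ℝ, X.IsRational f ∧ ∀ p, (D p : ℝ) = X.ord f p

/-- Linear equivalence of divisors. -/
def Equivalent (D₁ D₂ : X.Divisor) : Prop := X.IsPrincipal (D₁ - D₂)

/-! ### Subcurves, polarizations and quasistability -/

/-- Tropical subcurves (possibly empty, disconnected, or with isolated points): the subsets induced
by a subgraph of a subdivision of the model, i.e. those which meet every edge in a finite union of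
closed intervals, some of which may be single points. -/
def IsSubcurve (Y : Set X.Point) : Prop :=
  ∀ e : X.E, ∃ S : Finset (ℝ × ℝ),
    {t : ℝ | t ∈ Icc 0 (X.len e) ∧ X.pt e t ∈ Y} = ⋃ I ∈ S, Icc I.1 I.2

/-- `δ_Y`: the sum over the points `p` of `Y` of the number of directions of `X` at `p` that leave
`Y`. In a subdivision in which `Y` is a subgraph `Γ_Y`, this counts the pairs of a vertex of `Γ_Y`
and an edge not in `Γ_Y` that is incident to it, an edge being counted twice at a vertex if it is
a loop there. The first set collects the directions along the orientation of `e`, the second one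
those against it. -/
def delta (Y : Set X.Point) : ℕ :=
  ∑ e : X.E,
    ({t : ℝ | t ∈ Ico 0 (X.len e) ∧ X.pt e t ∈ Y ∧ ∀ᶠ s in 𝓝[>] t, X.pt e s ∉ Y}.ncard +
      {t : ℝ | t ∈ Ioc 0 (X.len e) ∧ X.pt e t ∈ Y ∧ ∀ᶠ s in 𝓝[<] t, X.pt e s ∉ Y}.ncard)

/-- A degree-`d` polarization: a real-valued function on the points, zero at all but finitely many,
whose values sum up to `d`. -/
def IsPolarization (μ : X.Point →₀ ℝ) (d : ℤ) : Prop := ∑ p ∈ μ.support, μ p = d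

/-- `β_D(Y) = deg(D|_Y) - μ(Y) + δ_Y / 2`. -/
def beta (μ : X.Point →₀ ℝ) (D : X.Divisor) (Y : Set X.Point) : ℝ :=
  ((∑ p ∈ D.support, Y.indicator D p : ℤ) : ℝ) - ∑ p ∈ μ.support, Y.indicator μ p
    + (X.delta Y : ℝ) / 2

/-- `D` is `μ`-semistable. -/
def IsSemistable (μ : X.Point →₀ ℝ) (D : X.Divisor) : Prop :=
  ∀ Y : Set X.Point, X.IsSubcurve Y → 0 ≤ X.beta μ D Y

/-- `D` is `(p₀, μ)`-quasistable. -/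
def IsQuasistable (p₀ : X.Point) (μ : X.Point →₀ ℝ) (D : X.Divisor) : Prop :=
  X.IsSemistable μ D ∧
    ∀ Y : Set X.Point, X.IsSubcurve Y → Y ≠ univ → p₀ ∈ Y → 0 < X.beta μ D Y

end TropicalCurve

end

/-! Uniqueness is a maximum principle. Let `D₁ - D₂ = div f` with `f` not constant, and let `Y` be
the locus where `f` is maximal. All slopes arriving at `Y` are nonnegative integers, and positive
along the directions that leave `Y`, so `deg (D₁ - D₂)|_Y ≥ δ_Y` (`IsRational.delta_le_degOn`). Let
`Z` be the complement of a small neighbourhood of `Y`, with `δ_Z ≤ δ_Y` and with `p₀` and the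
supports of `D₁` and `μ` inside `Y ∪ Z` (`IsSubcurve.exists_compl`). As `D₁` and `μ` both have
degree `d`, it follows that `β_{D₁}(Z) + β_{D₂}(Y) ≤ 0`. Both terms are nonnegative, and one of them
is positive because `p₀` lies in `Y` or in `Z`: a contradiction.

Existence is a variational argument. Subdivide `X` so that `p₀` and the supports of `D` and `μ` are
nodes. For a function `φ` on the nodes let `E(φ) = ∑ ℓ q(Δφ / ℓ) + ∑ (D - μ) φ`, where the first sum
runs over the segments and `q` is the convex piecewise linear interpolation of `x² / 2` at the
integers. Extend `φ` to a rational function by giving it on each segment the slopes `m = ⌊Δφ / ℓ⌋`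
and then `m + 1`, and add its divisor to `D` to get `D'`. The slopes `m + 1/2` of `q` are such that
the one-sided derivative of `E` at `φ` in the direction of the indicator of `Y` is at most
`β_{D'}(Y)`; this is checked segment by segment in `squareInterp_le_segmentBeta`. So a minimizer of
`E` gives a semistable `D'`.

Minimizers exist because `E` is coercive modulo constants. They need not be unique, and `p₀` breaks
the tie: among the minimizers that vanish at `p₀`, take one with the least sum of values. If raising
it on a set `S ≠ univ` of nodes with `p₀ ∈ S` did not change the energy, then lowering it on the
complement of `S` would give another such minimizer with a smaller sum. This yields the strict
inequalities (`exists_energy_minimizer`), except for `Y ≠ univ` that contains all nodes, where `β >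
0` is seen directly. -/

namespace TropicalCurve

/-! ### Finite unions of closed intervals -/

/-- Finite unions of closed intervals of real numbers. -/
def IsIccUnion (A : Set ℝ) : Prop := ∃ S : Finset (ℝ × ℝ), A = ⋃ I ∈ S, Icc I.1 I.2

namespace IsIccUnion

theorem isClosed {A : Set ℝ} (h : IsIccUnion A) : IsClosed A := by
  obtain ⟨S, rfl⟩ := h
  exact isClosed_biUnion_finset fun _ _ => isClosed_Icc

theorem empty : IsIccUnion ∅ := ⟨∅, by simp⟩

theorem icc (a b : ℝ) : IsIccUnion (Icc a b) := ⟨{(a, b)}, by simp⟩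

theorem union {A B : Set ℝ} (hA : IsIccUnion A) (hB : IsIccUnion B) : IsIccUnion (A ∪ B) := by
  classical
  obtain ⟨S, rfl⟩ := hA
  obtain ⟨T, rfl⟩ := hB
  exact ⟨S ∪ T, by rw [Finset.set_biUnion_union]⟩

theorem biUnion {ι : Type*} (s : Finset ι) {A : ι → Set ℝ} (h : ∀ i ∈ s, IsIccUnion (A i)) :
    IsIccUnion (⋃ i ∈ s, A i) := by
  classical
  induction s using Finset.induction_on with
  | empty => simpa using empty
  | insert a s _ ih =>
    rw [Finset.set_biUnion_insert]
    exact (h a (by simp)).union (ih fun i hi => h i (by simp [hi]))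

theorem diff_Ioo {A : Set ℝ} (hA : IsIccUnion A) (a b : ℝ) : IsIccUnion (A \ Ioo a b) := by
  obtain ⟨S, rfl⟩ := hA
  have key : (⋃ I ∈ S, Icc I.1 I.2) \ Ioo a b = ⋃ I ∈ S, (Icc I.1 I.2 \ Ioo a b) := by
    ext t; simp only [Set.mem_sdiff, mem_iUnion, exists_prop]; tauto
  rw [key]
  refine biUnion _ fun I _ => ?_
  have : Icc I.1 I.2 \ Ioo a b = Icc I.1 (min I.2 a) ∪ Icc (max I.1 b) I.2 := by
    ext t; simp only [Set.mem_sdiff, mem_Icc, mem_Ioo, mem_union, le_min_iff, max_le_iff]; grind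
  rw [this]
  exact (icc _ _).union (icc _ _)

/-- The points of an interval at distance at least `r` from a finite union of closed intervals. -/
theorem setOf_le_abs_sub {A : Set ℝ} (hA : IsIccUnion A) (c d : ℝ) {r : ℝ} (hr : 0 < r) :
    IsIccUnion {t | t ∈ Icc c d ∧ ∀ a ∈ A, r ≤ |t - a|} := by
  classical
  obtain ⟨S, rfl⟩ := hA
  induction S using Finset.induction_on with
  | empty =>
    convert icc c d using 1
    ext t; simp
  | insert I S _ ih =>
    by_cases hI : I.1 ≤ I.2
    -- Distance at least `r` from a nonempty `[I.1, I.2]` means lying outside `(I.1 - r, I.2 + r)`.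
    -- Pairs with `I.2 < I.1` describe the empty set and impose nothing.
    · convert (ih.diff_Ioo (I.1 - r) (I.2 + r)) using 1
      ext t
      simp only [Finset.set_biUnion_insert, mem_ofPred_eq, Set.mem_sdiff, mem_union, mem_Ioo, or_imp,
        forall_and, and_assoc]
      refine and_congr_right fun _ => ?_
      rw [and_comm]
      refine and_congr_right fun _ => ⟨fun h ht => ?_, fun h a ha => ?_⟩
      · rcases le_total t I.1 with h1 | h1
        · have := h I.1 ⟨le_rfl, hI⟩
          rw [abs_of_nonpos (by linarith)] at this
          linarith
        · rcases le_total I.2 t with h2 | h2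
          · have := h I.2 ⟨hI, le_rfl⟩
            rw [abs_of_nonneg (by linarith)] at this
            linarith
          · have := h t ⟨h1, h2⟩
            simp at this
            linarith
      · by_contra! hlt
        rw [abs_lt] at hlt
        exact h ⟨by linarith [ha.1], by linarith [ha.2]⟩
    · simpa [Finset.set_biUnion_insert, Icc_eq_empty hI] using ih

end IsIccUnion

variable (X : TropicalCurve.{u, v})

/-! ### Points of an edge -/

theorem pt_zero (e : X.E) : X.pt e 0 = .vertex (X.src e) := by simp [pt]

theorem pt_len (e : X.E) : X.pt e (X.len e) = .vertex (X.tgt e) := by simp [pt, X.len_pos e]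

theorem pt_of_mem_Ioo {e : X.E} {t : ℝ} (ht : t ∈ Ioo 0 (X.len e)) :
    X.pt e t = .interior e t ht.1 ht.2 := by simp [pt, ht.1, ht.2]

theorem pt_eq_interior_iff {e e' : X.E} {s t : ℝ} {h : 0 < t} {h' : t < X.len e} :
    X.pt e' s = .interior e t h h' ↔ e' = e ∧ s = t := by
  constructor
  · intro hs
    unfold pt at hs
    split_ifs at hs
    injection hs
    exact ⟨by assumption, by assumption⟩
  · rintro ⟨rfl, rfl⟩
    exact X.pt_of_mem_Ioo ⟨h, h'⟩

theorem pt_eq_vertex {e : X.E} {t : ℝ} {w : X.V} (h : X.pt e t = .vertex w)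
    (ht : t ∈ Icc 0 (X.len e)) : t = 0 ∨ t = X.len e := by
  by_contra! hne
  have : t ∈ Ioo 0 (X.len e) := ⟨lt_of_le_of_ne ht.1 hne.1.symm, lt_of_le_of_ne ht.2 hne.2⟩
  rw [X.pt_of_mem_Ioo this] at h
  cases h

/-- The parameters on `e` of the point `p`. -/
def fiber (p : X.Point) (e : X.E) : Set ℝ := {t | t ∈ Icc 0 (X.len e) ∧ X.pt e t = p}

theorem finite_fiber (p : X.Point) (e : X.E) : (X.fiber p e).Finite := by
  cases p with
  | vertex w =>
    exact (Set.toFinite {0, X.len e}).subset fun t ht => by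
      simpa using X.pt_eq_vertex ht.2 ht.1
  | interior e' t h h' =>
    exact (Set.toFinite {t}).subset fun s hs => by
      simpa using ((X.pt_eq_interior_iff).1 hs.2).2

/-! ### Subcurves -/

/-- The parameters on `e` of the points of `Y`. -/
def trace (Y : Set X.Point) (e : X.E) : Set ℝ := {t | t ∈ Icc 0 (X.len e) ∧ X.pt e t ∈ Y}

/-- The parameters at which `Y` is left along the orientation of `e`. -/
def exitsRight (Y : Set X.Point) (e : X.E) : Set ℝ :=
  {t | t ∈ Ico 0 (X.len e) ∧ X.pt e t ∈ Y ∧ ∀ᶠ s in 𝓝[>] t, X.pt e s ∉ Y}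

/-- The parameters at which `Y` is left against the orientation of `e`. -/
def exitsLeft (Y : Set X.Point) (e : X.E) : Set ℝ :=
  {t | t ∈ Ioc 0 (X.len e) ∧ X.pt e t ∈ Y ∧ ∀ᶠ s in 𝓝[<] t, X.pt e s ∉ Y}

theorem delta_eq (Y : Set X.Point) :
    X.delta Y = ∑ e : X.E, ((X.exitsRight Y e).ncard + (X.exitsLeft Y e).ncard) := rfl

variable {X}

theorem IsSubcurve.trace {Y : Set X.Point} (hY : X.IsSubcurve Y) (e : X.E) :
    IsIccUnion (X.trace Y e) := hY e

/-- An exit to the right can only be the right end of one of the intervals that make up the trace.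
-/
theorem IsSubcurve.finite_exitsRight {Y : Set X.Point} (hY : X.IsSubcurve Y) (e : X.E) :
    (X.exitsRight Y e).Finite := by
  classical
  obtain ⟨S, hS⟩ := hY e
  refine (S.image Prod.snd).finite_toSet.subset ?_
  rintro t ⟨ht, hY, hev⟩
  have hmem : t ∈ ⋃ I ∈ S, Icc I.1 I.2 := by rw [← hS]; exact ⟨⟨ht.1, ht.2.le⟩, hY⟩
  simp only [mem_iUnion, exists_prop] at hmem
  obtain ⟨I, hI, htI⟩ := hmem
  simp only [Finset.coe_image, mem_image, Finset.mem_coe]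
  refine ⟨I, hI, ?_⟩
  by_contra hne
  have hlt : t < I.2 := lt_of_le_of_ne htI.2 (Ne.symm hne)
  obtain ⟨s, hs, hsI⟩ := (hev.and (Ioo_mem_nhdsGT hlt)).exists
  have : s ∈ ⋃ I ∈ S, Icc I.1 I.2 := by
    simp only [mem_iUnion, exists_prop]
    exact ⟨I, hI, htI.1.trans hsI.1.le, hsI.2.le⟩
  rw [← hS] at this
  exact hs this.2

theorem IsSubcurve.finite_exitsLeft {Y : Set X.Point} (hY : X.IsSubcurve Y) (e : X.E) :
    (X.exitsLeft Y e).Finite := by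
  classical
  obtain ⟨S, hS⟩ := hY e
  refine (S.image Prod.fst).finite_toSet.subset ?_
  rintro t ⟨ht, hY, hev⟩
  have hmem : t ∈ ⋃ I ∈ S, Icc I.1 I.2 := by rw [← hS]; exact ⟨⟨ht.1.le, ht.2⟩, hY⟩
  simp only [mem_iUnion, exists_prop] at hmem
  obtain ⟨I, hI, htI⟩ := hmem
  simp only [Finset.coe_image, mem_image, Finset.mem_coe]
  refine ⟨I, hI, ?_⟩
  by_contra hne
  have hlt : I.1 < t := lt_of_le_of_ne htI.1 hne
  obtain ⟨s, hs, hsI⟩ := (hev.and (Ioo_mem_nhdsLT hlt)).exists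
  have : s ∈ ⋃ I ∈ S, Icc I.1 I.2 := by
    simp only [mem_iUnion, exists_prop]
    exact ⟨I, hI, hsI.1.le, hsI.2.le.trans htI.2⟩
  rw [← hS] at this
  exact hs this.2

/-- The trace is closed, so it has a largest parameter in `[a, b]`, and `Y` is left there. -/
theorem IsSubcurve.exists_exitRight {Y : Set X.Point} (hY : X.IsSubcurve Y) {e : X.E} {a b : ℝ}
    (ha : 0 ≤ a) (hb : b ≤ X.len e) (hab : a < b) (haY : X.pt e a ∈ Y) (hbY : X.pt e b ∉ Y) :
    ∃ t ∈ X.exitsRight Y e, t ∈ Ico a b := by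
  have hc : IsCompact (X.trace Y e ∩ Icc a b) := isCompact_Icc.inter_left (hY.trace e).isClosed
  obtain ⟨t, ⟨htY, ht⟩, hmax⟩ := hc.exists_isGreatest
    ⟨a, ⟨⟨ha, hab.le.trans hb⟩, haY⟩, le_rfl, hab.le⟩
  have htb : t < b := lt_of_le_of_ne ht.2 fun h => hbY (h ▸ htY.2)
  refine ⟨t, ⟨⟨htY.1.1, htb.trans_le hb⟩, htY.2, ?_⟩, ht.1, htb⟩
  filter_upwards [Ioo_mem_nhdsGT htb] with s hs hsY
  exact absurd (hmax ⟨⟨⟨htY.1.1.trans hs.1.le, hs.2.le.trans hb⟩, hsY⟩, ht.1.trans hs.1.le, hs.2.le⟩)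
    (not_le.2 hs.1)

theorem IsSubcurve.exists_exitLeft {Y : Set X.Point} (hY : X.IsSubcurve Y) {e : X.E} {a b : ℝ}
    (ha : 0 ≤ a) (hb : b ≤ X.len e) (hab : a < b) (haY : X.pt e a ∉ Y) (hbY : X.pt e b ∈ Y) :
    ∃ t ∈ X.exitsLeft Y e, t ∈ Ioc a b := by
  have hc : IsCompact (X.trace Y e ∩ Icc a b) := isCompact_Icc.inter_left (hY.trace e).isClosed
  obtain ⟨t, ⟨htY, ht⟩, hmin⟩ := hc.exists_isLeast
    ⟨b, ⟨⟨ha.trans hab.le, hb⟩, hbY⟩, hab.le, le_rfl⟩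
  have hta : a < t := lt_of_le_of_ne ht.1 fun h => haY (h ▸ htY.2)
  refine ⟨t, ⟨⟨ha.trans_lt hta, htY.1.2⟩, htY.2, ?_⟩, hta, ht.2⟩
  filter_upwards [Ioo_mem_nhdsLT hta] with s hs hsY
  exact absurd (hmin ⟨⟨⟨ha.trans hs.1.le, hs.2.le.trans htY.1.2⟩, hsY⟩, hs.1.le, hs.2.le.trans ht.2⟩)
    (not_le.2 hs.2)

/-- The complement of a small open neighbourhood of a subcurve `Y`: it is a subcurve that is left
in at most as many directions as `Y`, and contains any finitely many prescribed points outside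
of `Y`. -/
theorem IsSubcurve.exists_compl {Y : Set X.Point} (hY : X.IsSubcurve Y) {P : Set X.Point}
    (hP : P.Finite) :
    ∃ Z : Set X.Point, X.IsSubcurve Z ∧ Disjoint Y Z ∧ P ⊆ Y ∪ Z ∧ X.delta Z ≤ X.delta Y := by
  have hPV : (P ∪ range Point.vertex).Finite := hP.union (Set.finite_range _)
  -- The vertices are included along with `P`: a vertex outside `Y` then keeps distance `r` from `Y`
  -- on every incident edge, so membership in `Z` can be tested on a single edge (`htr`).
  have hev : ∀ᶠ r in 𝓝[>] (0 : ℝ), ∀ p ∈ P ∪ range Point.vertex, ∀ e : X.E, ∀ t ∈ X.fiber p e,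
      p ∉ Y → ∀ a ∈ X.trace Y e, r ≤ |t - a| := by
    rw [eventually_all_finite hPV]
    refine fun p _ => eventually_all.2 fun e => (eventually_all_finite (X.finite_fiber p e)).2 ?_
    intro t ht
    by_cases hpY : p ∈ Y
    · simp [hpY]
    have : t ∈ (X.trace Y e)ᶜ := fun h => hpY (ht.2 ▸ h.2)
    obtain ⟨η, hη, hball⟩ := Metric.isOpen_iff.1 (hY.trace e).isClosed.isOpen_compl t this
    filter_upwards [Ioo_mem_nhdsGT hη] with r hr _ a ha
    by_contra! hlt
    exact hball (by rw [Metric.mem_ball, dist_comm, Real.dist_eq]; linarith [hr.2]) ha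
  obtain ⟨r, hr, hr0⟩ := (hev.and self_mem_nhdsWithin).exists
  replace hr0 : 0 < r := hr0
  set Z : Set X.Point := {p | p ∉ Y ∧ ∀ e, ∀ t ∈ X.fiber p e, ∀ a ∈ X.trace Y e, r ≤ |t - a|}
    with hZ
  have htr : ∀ e, X.trace Z e = {t | t ∈ Icc 0 (X.len e) ∧ ∀ a ∈ X.trace Y e, r ≤ |t - a|} := by
    intro e
    ext t
    refine and_congr_right fun ht => ⟨fun h => h.2 e t ⟨ht, rfl⟩, fun h => ?_⟩
    have hnY : X.pt e t ∉ Y := fun htY => by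
      have := h t ⟨ht, htY⟩
      simp at this
      linarith
    refine ⟨hnY, ?_⟩
    cases hp : X.pt e t with
    | vertex w =>
      intro e' t' ht'
      exact hr _ (Or.inr ⟨w, rfl⟩) e' t' ht' (hp ▸ hnY)
    | interior e₁ t₁ h₁ h₁' =>
      intro e' t' ht'
      obtain ⟨rfl, rfl⟩ := X.pt_eq_interior_iff.1 hp
      obtain ⟨rfl, rfl⟩ := X.pt_eq_interior_iff.1 ht'.2
      exact h
  have hZsub : X.IsSubcurve Z := by
    intro e
    change IsIccUnion (X.trace Z e)
    rw [htr]
    exact (hY.trace e).setOf_le_abs_sub _ _ hr0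
  have memZ : ∀ {e t}, t ∈ Icc 0 (X.len e) → (X.pt e t ∈ Z ↔ ∀ a ∈ X.trace Y e, r ≤ |t - a|) := by
    intro e t ht
    have := Set.ext_iff.1 (htr e) t
    simpa [TropicalCurve.trace, ht.1, ht.2] using this
  refine ⟨Z, hZsub, Set.disjoint_left.2 fun p hp hp' => hp'.1 hp, fun p hp => ?_, ?_⟩
  · by_cases hpY : p ∈ Y
    · exact Or.inl hpY
    · exact Or.inr ⟨hpY, fun e t ht => hr p (Or.inl hp) e t ht hpY⟩
  · rw [delta_eq, delta_eq]
    refine Finset.sum_le_sum fun e _ => ?_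
    -- Shifting by `r` turns an exit of `Z` to the right into an exit of `Y` to the left at the far
    -- side of the gap, and vice versa. Gaps too narrow to meet `Z` only make `δ_Z` smaller.
    rw [add_comm (X.exitsRight Y e).ncard]
    refine add_le_add
      (Set.ncard_le_ncard_of_injOn (fun t => t + r) ?_ (fun _ _ _ _ h => by simpa using h)
        (hY.finite_exitsLeft e))
      (Set.ncard_le_ncard_of_injOn (fun t => t - r) ?_ (fun _ _ _ _ h => by simpa using h)
        (hY.finite_exitsRight e))
    · rintro t ⟨ht, htZ, hev⟩
      rw [memZ ⟨ht.1, ht.2.le⟩] at htZ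
      -- Just after `t` the distance to `Y` drops below `r`, so `Y` has points arbitrarily close to
      -- `t + r`; the trace is closed.
      have hmem : t + r ∈ X.trace Y e := by
        by_contra hn
        obtain ⟨η, hη, hball⟩ :=
          Metric.isOpen_iff.1 (hY.trace e).isClosed.isOpen_compl (t + r) hn
        obtain ⟨s, ⟨hs, hs1⟩, hs2⟩ := ((hev.and (Ioo_mem_nhdsGT ht.2)).and
          (Ioo_mem_nhdsGT (show t < t + η by linarith))).exists
        rw [memZ ⟨ht.1.trans hs1.1.le, hs1.2.le⟩] at hs
        push Not at hs
        obtain ⟨a, haY, ha⟩ := hs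
        have h1 := htZ a haY
        rw [abs_lt] at ha
        rw [le_abs] at h1
        refine hball ?_ haY
        rw [Metric.mem_ball, Real.dist_eq, abs_lt]
        have := hs2.2
        have := hs2.1
        constructor <;> rcases h1 with h1 | h1 <;> linarith
      refine ⟨⟨by linarith [ht.1], hmem.1.2⟩, hmem.2, ?_⟩
      filter_upwards [Ioo_mem_nhdsLT (show t < t + r by linarith)] with s hs hsY
      have := htZ s ⟨⟨ht.1.trans hs.1.le, hs.2.le.trans hmem.1.2⟩, hsY⟩
      rw [abs_of_nonpos (by linarith [hs.1])] at this
      linarith [hs.2]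
    · rintro t ⟨ht, htZ, hev⟩
      rw [memZ ⟨ht.1.le, ht.2⟩] at htZ
      have hmem : t - r ∈ X.trace Y e := by
        by_contra hn
        obtain ⟨η, hη, hball⟩ :=
          Metric.isOpen_iff.1 (hY.trace e).isClosed.isOpen_compl (t - r) hn
        obtain ⟨s, ⟨hs, hs1⟩, hs2⟩ := ((hev.and (Ioo_mem_nhdsLT ht.1)).and
          (Ioo_mem_nhdsLT (show t - η < t by linarith))).exists
        rw [memZ ⟨hs1.1.le, hs1.2.le.trans ht.2⟩] at hs
        push Not at hs
        obtain ⟨a, haY, ha⟩ := hs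
        have h1 := htZ a haY
        rw [abs_lt] at ha
        rw [le_abs] at h1
        refine hball ?_ haY
        rw [Metric.mem_ball, Real.dist_eq, abs_lt]
        have := hs2.2
        have := hs2.1
        constructor <;> rcases h1 with h1 | h1 <;> linarith
      refine ⟨⟨hmem.1.1, by linarith [ht.2]⟩, hmem.2, ?_⟩
      filter_upwards [Ioo_mem_nhdsGT (show t - r < t by linarith)] with s hs hsY
      have := htZ s ⟨⟨hmem.1.1.trans hs.1.le, hs.2.le.trans ht.2⟩, hsY⟩
      rw [abs_of_nonneg (by linarith [hs.2])] at this
      linarith [hs.1]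

/-! ### Piecewise linear functions with integer slopes -/

/-- `g` is linear with integer slope on every subinterval of `[0, ℓ]` that contains no point of `T`
in its interior. -/
def IsLinearOff (g : ℝ → ℝ) (ℓ : ℝ) (T : Finset ℝ) : Prop :=
  ∀ a b, 0 ≤ a → a ≤ b → b ≤ ℓ → (∀ τ ∈ T, τ ∉ Ioo a b) →
    ∃ k : ℤ, ∀ s ∈ Icc a b, g s = g a + k * (s - a)

/-- A finite set of parameters can be completed to a subdivision of `[0, ℓ]`. -/
theorem exists_subdivision (T : Finset ℝ) {ℓ : ℝ} (hℓ : 0 < ℓ) :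
    ∃ (n : ℕ) (t : ℕ → ℝ), Monotone t ∧ t 0 = 0 ∧ t n = ℓ ∧ (∀ i < n, t i < t (i + 1)) ∧
      ∀ τ ∈ T, τ ∈ Icc 0 ℓ → ∃ i ≤ n, t i = τ := by
  classical
  set T' : Finset ℝ := (insert 0 (insert ℓ T)).filter (fun τ => τ ∈ Icc 0 ℓ) with hT'
  have h0 : (0 : ℝ) ∈ T' := by simp [hT', hℓ.le]
  have hl : ℓ ∈ T' := by simp [hT', hℓ.le]
  obtain ⟨n, hn⟩ : ∃ n, T'.card = n + 1 :=
    Nat.exists_eq_succ_of_ne_zero (Finset.card_pos.2 ⟨0, h0⟩).ne'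
  have hbd : ∀ τ ∈ T', τ ∈ Icc 0 ℓ := fun τ h => (Finset.mem_filter.1 h).2
  set o := T'.orderEmbOfFin hn with ho
  have surj : ∀ τ ∈ T', ∃ i, o i = τ := fun τ h => by
    have : τ ∈ range o := by rw [ho, Finset.range_orderEmbOfFin]; exact h
    exact this
  have hmem : ∀ i, o i ∈ T' := fun i => T'.orderEmbOfFin_mem hn i
  -- Past the index `n` the sequence stays at `ℓ`, which keeps it monotone on all of `ℕ`.
  refine ⟨n, fun i => o ⟨min i n, by omega⟩, ?_, ?_, ?_, ?_, ?_⟩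
  · intro i j hij
    exact o.monotone (by simp only [Fin.mk_le_mk]; omega)
  · refine le_antisymm ?_ (hbd _ (hmem _)).1
    obtain ⟨i, hi⟩ := surj 0 h0
    rw [← hi]
    exact o.monotone (by simp)
  · refine le_antisymm (hbd _ (hmem _)).2 ?_
    obtain ⟨i, hi⟩ := surj ℓ hl
    rw [← hi]
    exact o.monotone (by simp only [Fin.le_def]; omega)
  · intro i hi
    exact o.strictMono (by simp only [Fin.lt_def]; omega)
  · intro τ hτ hτI
    obtain ⟨i, hi⟩ := surj τ (by simp only [hT', Finset.mem_filter, Finset.mem_insert]; tauto)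
    refine ⟨i, by omega, ?_⟩
    rw [← hi]
    exact congrArg o (Fin.ext (by simp only; omega))

/-- A point of a subdivided interval `[t 0, t n)` lies in one of the pieces. -/
theorem exists_mem_Ico_subdivision {t : ℕ → ℝ} {n : ℕ} {a : ℝ} (h0 : t 0 ≤ a) (hn : a < t n) :
    ∃ i < n, a ∈ Ico (t i) (t (i + 1)) := by
  induction n with
  | zero => linarith
  | succ n ih =>
    by_cases h : a < t n
    · obtain ⟨i, hi, hmem⟩ := ih h
      exact ⟨i, by omega, hmem⟩
    · exact ⟨n, by omega, not_lt.1 h, hn⟩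

theorem IsLinearOff.mono {g : ℝ → ℝ} {ℓ : ℝ} {T T' : Finset ℝ} (h : IsLinearOff g ℓ T)
    (hT : T ⊆ T') : IsLinearOff g ℓ T' :=
  fun a b ha hab hb hτ => h a b ha hab hb fun τ h' => hτ τ (hT h')

theorem IsLinearOff.sub {g₁ g₂ : ℝ → ℝ} {ℓ : ℝ} {T : Finset ℝ} (h₁ : IsLinearOff g₁ ℓ T)
    (h₂ : IsLinearOff g₂ ℓ T) : IsLinearOff (fun s => g₁ s - g₂ s) ℓ T := by
  intro a b ha hab hb hτ
  obtain ⟨k₁, hk₁⟩ := h₁ a b ha hab hb hτ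
  obtain ⟨k₂, hk₂⟩ := h₂ a b ha hab hb hτ
  refine ⟨k₁ - k₂, fun s hs => ?_⟩
  simp only [hk₁ s hs, hk₂ s hs]
  push_cast
  ring

theorem IsLinearOff.exists_slopeBefore {g : ℝ → ℝ} {ℓ : ℝ} {T : Finset ℝ} (h : IsLinearOff g ℓ T)
    {t : ℝ} (ht : t ∈ Ioc 0 ℓ) : ∃ k : ℤ, ∀ᶠ s in 𝓝[<] t, g s = g t + k * (s - t) := by
  have hev : ∀ᶠ a in 𝓝[<] t, ∀ τ ∈ T, τ ∉ Ioo a t := by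
    rw [T.eventually_all]
    intro τ _
    rcases lt_or_ge τ t with hτ | hτ
    · filter_upwards [Ioo_mem_nhdsLT hτ] with a ha h'
      exact absurd h'.1 (not_lt.2 ha.1.le)
    · exact Eventually.of_forall fun a h' => absurd h'.2 (not_lt.2 hτ)
  obtain ⟨a, haT, ha⟩ := (hev.and (Ioo_mem_nhdsLT ht.1)).exists
  obtain ⟨k, hk⟩ := h a t ha.1.le ha.2.le ht.2 haT
  refine ⟨k, ?_⟩
  filter_upwards [Ioo_mem_nhdsLT ha.2] with s hs
  rw [hk s ⟨hs.1.le, hs.2.le⟩, hk t ⟨ha.2.le, le_rfl⟩]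
  ring

theorem IsLinearOff.exists_slopeAfter {g : ℝ → ℝ} {ℓ : ℝ} {T : Finset ℝ} (h : IsLinearOff g ℓ T)
    {t : ℝ} (ht : t ∈ Ico 0 ℓ) : ∃ k : ℤ, ∀ᶠ s in 𝓝[>] t, g s = g t + k * (s - t) := by
  have hev : ∀ᶠ b in 𝓝[>] t, ∀ τ ∈ T, τ ∉ Ioo t b := by
    rw [T.eventually_all]
    intro τ _
    rcases lt_or_ge t τ with hτ | hτ
    · filter_upwards [Ioo_mem_nhdsGT hτ] with b hb h'
      exact absurd h'.2 (not_lt.2 hb.2.le)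
    · exact Eventually.of_forall fun a h' => absurd h'.1 (not_lt.2 hτ)
  obtain ⟨b, hbT, hb⟩ := (hev.and (Ioo_mem_nhdsGT ht.2)).exists
  obtain ⟨k, hk⟩ := h t b ht.1 hb.1.le hb.2.le hbT
  refine ⟨k, ?_⟩
  filter_upwards [Ioo_mem_nhdsGT hb.1] with s hs
  exact hk s ⟨hs.1.le, hs.2.le⟩

theorem hasDerivWithinAt_of_eventually_linear {g : ℝ → ℝ} {t k : ℝ} {S : Set ℝ}
    (h : ∀ᶠ s in 𝓝[S] t, g s = g t + k * (s - t)) : HasDerivWithinAt g k S t := by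
  have : HasDerivWithinAt (fun s => g t + k * (s - t)) k S t := by
    simpa using (((hasDerivWithinAt_id t S).sub_const t).const_mul k).const_add (g t)
  exact this.congr_of_eventuallyEq h (by simp)

theorem slopeBefore_eq {f : X.Point → ℝ} {e : X.E} {t k : ℝ}
    (h : ∀ᶠ s in 𝓝[<] t, f (X.pt e s) = f (X.pt e t) + k * (s - t)) : X.slopeBefore f e t = k :=
  (hasDerivWithinAt_of_eventually_linear (g := fun s => f (X.pt e s)) h).derivWithin
    (uniqueDiffWithinAt_Iio t)

theorem slopeAfter_eq {f : X.Point → ℝ} {e : X.E} {t k : ℝ}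
    (h : ∀ᶠ s in 𝓝[>] t, f (X.pt e s) = f (X.pt e t) + k * (s - t)) : X.slopeAfter f e t = k :=
  (hasDerivWithinAt_of_eventually_linear (g := fun s => f (X.pt e s)) h).derivWithin
    (uniqueDiffWithinAt_Ioi t)

/-- In this form the set of break points may be enlarged freely, so two functions can be compared
without constructing a common subdivision. -/
theorem isRational_iff {f : X.Point → ℝ} :
    X.IsRational f ↔
      Continuous f ∧ ∀ e, ∃ T, IsLinearOff (fun s => f (X.pt e s)) (X.len e) T := by
  classical
  refine and_congr_right fun _ => forall_congr' fun e => ⟨?_, ?_⟩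
  · rintro ⟨n, t, m, hmono, h0, hn, hlin⟩
    refine ⟨(Finset.range (n + 1)).image t, fun a b ha hab hb hT => ?_⟩
    rcases hab.eq_or_lt with rfl | hab
    · exact ⟨0, fun s hs => by simp [le_antisymm hs.2 hs.1]⟩
    obtain ⟨i, hi, hai⟩ := exists_mem_Ico_subdivision (h0.trans_le ha) (hn ▸ hab.trans_le hb)
    have hbi : b ≤ t (i + 1) := by
      by_contra! hlt
      refine hT (t (i + 1)) (Finset.mem_image_of_mem _ (by simp; omega)) ⟨hai.2, hlt⟩
    refine ⟨m i, fun s hs => ?_⟩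
    simp only
    rw [hlin i hi s ⟨hai.1.trans hs.1, hs.2.trans hbi⟩, hlin i hi a ⟨hai.1, hai.2.le⟩]
    ring
  · rintro ⟨T, hT⟩
    obtain ⟨n, t, hmono, h0, hn, hlt, hTt⟩ := exists_subdivision T (X.len_pos e)
    have key : ∀ i, ∃ k : ℤ, i < n → ∀ s ∈ Icc (t i) (t (i + 1)),
        f (X.pt e s) = f (X.pt e (t i)) + k * (s - t i) := by
      intro i
      by_cases hi : i < n
      · have h1 : 0 ≤ t i := h0 ▸ hmono (Nat.zero_le i)
        have h2 : t (i + 1) ≤ X.len e := hn ▸ hmono hi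
        obtain ⟨k, hk⟩ := hT (t i) (t (i + 1)) h1 (hlt i hi).le h2 (by
          intro τ hτ hτI
          obtain ⟨j, _, rfl⟩ := hTt τ hτ ⟨h1.trans hτI.1.le, hτI.2.le.trans h2⟩
          have := hmono.reflect_lt hτI.1
          have := hmono.reflect_lt hτI.2
          omega)
        exact ⟨k, fun _ => hk⟩
      · exact ⟨0, fun h => absurd h hi⟩
    choose m hm using key
    exact ⟨n, t, m, hmono, h0, hn, hm⟩

theorem IsRational.exists_slopeBefore {f : X.Point → ℝ} (hf : X.IsRational f) {e : X.E} {t : ℝ}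
    (ht : t ∈ Ioc 0 (X.len e)) :
    ∃ k : ℤ, ∀ᶠ s in 𝓝[<] t, f (X.pt e s) = f (X.pt e t) + k * (s - t) := by
  obtain ⟨T, hT⟩ := (isRational_iff.1 hf).2 e
  exact hT.exists_slopeBefore ht

theorem IsRational.exists_slopeAfter {f : X.Point → ℝ} (hf : X.IsRational f) {e : X.E} {t : ℝ}
    (ht : t ∈ Ico 0 (X.len e)) :
    ∃ k : ℤ, ∀ᶠ s in 𝓝[>] t, f (X.pt e s) = f (X.pt e t) + k * (s - t) := by
  obtain ⟨T, hT⟩ := (isRational_iff.1 hf).2 e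
  exact hT.exists_slopeAfter ht

theorem IsRational.sub {f g : X.Point → ℝ} (hf : X.IsRational f) (hg : X.IsRational g) :
    X.IsRational (fun p => f p - g p) := by
  classical
  rw [isRational_iff] at hf hg ⊢
  refine ⟨hf.1.sub hg.1, fun e => ?_⟩
  obtain ⟨T₁, h₁⟩ := hf.2 e
  obtain ⟨T₂, h₂⟩ := hg.2 e
  exact ⟨T₁ ∪ T₂, (h₁.mono Finset.subset_union_left).sub (h₂.mono Finset.subset_union_right)⟩

variable (X) in
theorem finite_fiber_Ioc (p : X.Point) (e : X.E) :
    {t : ℝ | t ∈ Ioc 0 (X.len e) ∧ X.pt e t = p}.Finite :=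
  (X.finite_fiber p e).subset fun _ ht => ⟨⟨ht.1.1.le, ht.1.2⟩, ht.2⟩

variable (X) in
theorem finite_fiber_Ico (p : X.Point) (e : X.E) :
    {t : ℝ | t ∈ Ico 0 (X.len e) ∧ X.pt e t = p}.Finite :=
  (X.finite_fiber p e).subset fun _ ht => ⟨⟨ht.1.1, ht.1.2.le⟩, ht.2⟩

theorem IsRational.ord_sub {f g : X.Point → ℝ} (hf : X.IsRational f) (hg : X.IsRational g)
    (p : X.Point) : X.ord (fun p => f p - g p) p = X.ord f p - X.ord g p := by
  unfold ord
  rw [← Finset.sum_sub_distrib]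
  refine Finset.sum_congr rfl fun e _ => ?_
  rw [sub_sub_sub_comm, ← finsum_mem_sub_distrib _ _ (X.finite_fiber_Ioc p e),
    ← finsum_mem_sub_distrib _ _ (X.finite_fiber_Ico p e)]
  congr 1
  · refine finsum_mem_congr rfl fun t ht => ?_
    obtain ⟨k₁, h₁⟩ := hf.exists_slopeBefore ht.1
    obtain ⟨k₂, h₂⟩ := hg.exists_slopeBefore ht.1
    rw [slopeBefore_eq h₁, slopeBefore_eq h₂]
    refine slopeBefore_eq ?_
    filter_upwards [h₁, h₂] with s hs₁ hs₂
    rw [hs₁, hs₂]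
    ring
  · refine finsum_mem_congr rfl fun t ht => ?_
    obtain ⟨k₁, h₁⟩ := hf.exists_slopeAfter ht.1
    obtain ⟨k₂, h₂⟩ := hg.exists_slopeAfter ht.1
    rw [slopeAfter_eq h₁, slopeAfter_eq h₂]
    refine slopeAfter_eq ?_
    filter_upwards [h₁, h₂] with s hs₁ hs₂
    rw [hs₁, hs₂]
    ring

theorem IsPrincipal.sub {D₁ D₂ : X.Divisor} (h₁ : X.IsPrincipal D₁) (h₂ : X.IsPrincipal D₂) :
    X.IsPrincipal (D₁ - D₂) := by
  obtain ⟨f, hf, hf'⟩ := h₁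
  obtain ⟨g, hg, hg'⟩ := h₂
  refine ⟨_, hf.sub hg, fun p => ?_⟩
  rw [hf.ord_sub hg, ← hf', ← hg']
  simp

/-! ### Degrees on subsets -/

/-- The sum of the values of `D` on `Y`. -/
noncomputable def degOn {M : Type*} [AddCommMonoid M] (Y : Set X.Point) : (X.Point →₀ M) →+ M where
  toFun D := ∑ p ∈ D.support, Y.indicator D p
  map_zero' := by simp
  map_add' D D' := by
    classical
    have h : ∀ {A : X.Point →₀ M} {F : Finset X.Point}, A.support ⊆ F →
        ∑ p ∈ A.support, Y.indicator A p = ∑ p ∈ F, Y.indicator A p := fun {A F} hF =>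
      Finset.sum_subset hF fun p _ hp => by
        by_cases hY : p ∈ Y <;> simp_all
    rw [h (Finsupp.support_add (g₁ := D) (g₂ := D')), h (A := D) Finset.subset_union_left,
      h (A := D') Finset.subset_union_right, ← Finset.sum_add_distrib]
    refine Finset.sum_congr rfl fun p _ => ?_
    by_cases hp : p ∈ Y <;> simp [hp]

section DegOn

variable {M : Type*} [AddCommMonoid M]

theorem degOn_eq_sum {D : X.Point →₀ M} {F : Finset X.Point} (hF : D.support ⊆ F)
    (Y : Set X.Point) : degOn Y D = ∑ p ∈ F, Y.indicator D p :=
  Finset.sum_subset hF fun p _ hp => by by_cases hY : p ∈ Y <;> simp_all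

theorem degOn_single (Y : Set X.Point) (p : X.Point) (a : M) :
    degOn Y (Finsupp.single p a) = Y.indicator (fun _ => a) p := by
  rw [degOn_eq_sum (F := {p}) Finsupp.support_single_subset]
  by_cases h : p ∈ Y <;> simp [h]

theorem degOn_add_degOn {D : X.Point →₀ M} {Y Z : Set X.Point} (hYZ : Disjoint Y Z)
    (hD : (D.support : Set X.Point) ⊆ Y ∪ Z) :
    degOn Y D + degOn Z D = ∑ p ∈ D.support, D p := by
  rw [degOn_eq_sum subset_rfl, degOn_eq_sum subset_rfl, ← Finset.sum_add_distrib]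
  refine Finset.sum_congr rfl fun p hp => ?_
  rcases hD hp with h | h
  · simp [h, Set.disjoint_left.1 hYZ h]
  · simp [h, Set.disjoint_right.1 hYZ h]

end DegOn

theorem beta_eq (μ : X.Point →₀ ℝ) (D : X.Divisor) (Y : Set X.Point) :
    X.beta μ D Y = (degOn Y D : ℤ) - degOn Y μ + (X.delta Y : ℝ) / 2 := rfl

theorem deg_eq_degOn (D : X.Divisor) : X.deg D = degOn univ D := by
  rw [degOn_eq_sum subset_rfl]
  simp [deg]

/-! ### The locus where a rational function is maximal -/

theorem continuousOn_comp_pt {f : X.Point → ℝ} (hf : Continuous f) (e : X.E) :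
    ContinuousOn (fun t => f (X.pt e t)) (Icc 0 (X.len e)) := by
  rw [continuousOn_iff_continuous_domRestrict]
  exact continuous_coinduced_dom.1 (continuous_iSup_dom.1 hf e)

/-- The values lie in a finite union of compact images of the closed edges. The vertices are added
separately because a curve may consist of one vertex and no edge. -/
theorem exists_forall_le {f : X.Point → ℝ} (hf : Continuous f) : ∃ p, ∀ q, f q ≤ f p := by
  have hK : IsCompact (f '' range Point.vertex ∪
      ⋃ e, (fun t => f (X.pt e t)) '' Icc 0 (X.len e)) :=
    ((Set.finite_range _).image f).isCompact.union
      (isCompact_iUnion fun e => isCompact_Icc.image_of_continuousOn (continuousOn_comp_pt hf e))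
  have hsub : ∀ q, f q ∈ f '' range Point.vertex ∪
      ⋃ e, (fun t => f (X.pt e t)) '' Icc 0 (X.len e) := by
    intro q
    cases q with
    | vertex w => exact Or.inl ⟨_, ⟨w, rfl⟩, rfl⟩
    | interior e t h h' =>
      exact Or.inr (mem_iUnion.2 ⟨e, t, ⟨h.le, h'.le⟩, by simp only [X.pt_of_mem_Ioo ⟨h, h'⟩]⟩)
  obtain ⟨w⟩ := X.nonempty
  obtain ⟨M, hM, hmax⟩ := hK.exists_isGreatest ⟨_, hsub (.vertex w)⟩
  obtain ⟨p, rfl⟩ : ∃ p, f p = M := by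
    rcases hM with ⟨p, _, hp⟩ | hM
    · exact ⟨p, hp⟩
    · obtain ⟨e, t, _, ht⟩ := mem_iUnion.1 hM
      exact ⟨_, ht⟩
  exact ⟨p, fun q => hmax (hsub q)⟩

/-- On a linear piece the level set is the whole piece, empty, or a single point. -/
theorem IsRational.isSubcurve_level {f : X.Point → ℝ} (hf : X.IsRational f) (M : ℝ) :
    X.IsSubcurve {p | f p = M} := by
  intro e
  change IsIccUnion _
  obtain ⟨n, t, m, hmono, h0, hn, hlin⟩ := hf.2 e
  have key : {s | s ∈ Icc 0 (X.len e) ∧ X.pt e s ∈ {p | f p = M}} =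
      ⋃ i ∈ Finset.range n, {s | s ∈ Icc (t i) (t (i + 1)) ∧ f (X.pt e s) = M} := by
    ext s
    simp only [mem_ofPred_eq, mem_iUnion, Finset.mem_range, exists_prop]
    constructor
    · rintro ⟨hs, hsM⟩
      rcases hs.2.lt_or_eq with hlt | rfl
      · obtain ⟨i, hi, hsi⟩ := exists_mem_Ico_subdivision (h0.trans_le hs.1) (hn ▸ hlt)
        exact ⟨i, hi, ⟨hsi.1, hsi.2.le⟩, hsM⟩
      · have hn0 : n ≠ 0 := by
          rintro rfl
          linarith [X.len_pos e]
        obtain ⟨k, rfl⟩ := Nat.exists_eq_succ_of_ne_zero hn0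
        exact ⟨k, by omega, ⟨hn ▸ hmono (Nat.le_succ k), hn.ge⟩, hsM⟩
    · rintro ⟨i, hi, hs, hsM⟩
      exact ⟨⟨(h0 ▸ hmono (Nat.zero_le i)).trans hs.1, hs.2.trans (hn ▸ hmono hi)⟩, hsM⟩
  rw [key]
  refine IsIccUnion.biUnion _ fun i hi => ?_
  have hl := hlin i (Finset.mem_range.1 hi)
  by_cases hm : m i = 0
  · by_cases hM : f (X.pt e (t i)) = M
    · convert IsIccUnion.icc (t i) (t (i + 1)) using 1
      ext s
      refine and_iff_left_of_imp fun hs => ?_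
      rw [hl s hs, hm, hM]
      simp
    · convert IsIccUnion.empty using 1
      ext s
      simp only [mem_ofPred_eq, mem_empty_iff_false, iff_false, not_and]
      intro hs
      rw [hl s hs, hm]
      simpa using hM
  · have hm' : (m i : ℝ) ≠ 0 := by exact_mod_cast hm
    set s₀ := t i + (M - f (X.pt e (t i))) / m i with hs₀
    -- This interval is `{s₀}` if the solution `s₀` of the linear equation lies in the piece, and
    -- empty otherwise.
    convert IsIccUnion.icc (max (t i) s₀) (min (t (i + 1)) s₀) using 1
    ext s
    simp only [mem_ofPred_eq, mem_Icc, max_le_iff, le_min_iff]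
    have : s ∈ Icc (t i) (t (i + 1)) → (f (X.pt e s) = M ↔ s = s₀) := by
      intro hs
      rw [hl s hs, hs₀]
      constructor
      · intro h
        field_simp
        linarith
      · rintro rfl
        field_simp
        ring
    constructor
    · rintro ⟨hs, hsM⟩
      have := (this hs).1 hsM
      exact ⟨⟨hs.1, this.ge⟩, hs.2, this.le⟩
    · rintro ⟨h1, h2⟩
      exact ⟨⟨h1.1, h2.1⟩, (this ⟨h1.1, h2.1⟩).2 (le_antisymm h2.2 h1.2)⟩

theorem finsum_mem_ge_ncard {A B : Set ℝ} (hA : A.Finite) {g : ℝ → ℝ} (hBA : B ⊆ A)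
    (h0 : ∀ t ∈ A, 0 ≤ g t) (h1 : ∀ t ∈ B, 1 ≤ g t) : (B.ncard : ℝ) ≤ ∑ᶠ t ∈ A, g t := by
  classical
  rw [finsum_mem_eq_finite_toFinset_sum _ hA, Set.ncard_eq_toFinset_card _ (hA.subset hBA),
    Finset.card_eq_sum_ones, Nat.cast_sum]
  refine (Finset.sum_le_sum (g := g) fun t ht => ?_).trans
    (Finset.sum_le_sum_of_subset_of_nonneg (fun t ht => ?_) fun t ht _ => ?_)
  · simpa using h1 t (by simpa using ht)
  · simp only [Finite.mem_toFinset] at ht ⊢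
    exact hBA ht
  · exact h0 t (by simpa using ht)

/-- Where a rational function is maximal, its order is at least the number of directions in which
it decreases. -/
theorem IsRational.card_exits_le_ord {f : X.Point → ℝ} (hf : X.IsRational f) {p : X.Point}
    (hp : ∀ q, f q ≤ f p) :
    ((∑ e : X.E, ({t ∈ X.exitsRight {q | f q = f p} e | X.pt e t = p}.ncard +
      {t ∈ X.exitsLeft {q | f q = f p} e | X.pt e t = p}.ncard) : ℕ) : ℝ) ≤ X.ord f p := by
  unfold ord
  rw [Nat.cast_sum]
  refine Finset.sum_le_sum fun e _ => ?_
  have hL : ({t ∈ X.exitsLeft {q | f q = f p} e | X.pt e t = p}.ncard : ℝ) ≤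
      ∑ᶠ t ∈ {t : ℝ | t ∈ Ioc 0 (X.len e) ∧ X.pt e t = p}, X.slopeBefore f e t := by
    have key : ∀ t, t ∈ Ioc 0 (X.len e) → X.pt e t = p → 0 ≤ X.slopeBefore f e t ∧
        (t ∈ X.exitsLeft {q | f q = f p} e → 1 ≤ X.slopeBefore f e t) := by
      intro t ht htp
      obtain ⟨k, hk⟩ := hf.exists_slopeBefore ht
      rw [slopeBefore_eq hk]
      have h0 : (0 : ℝ) ≤ k := by
        obtain ⟨s, hs, hst⟩ := (hk.and self_mem_nhdsWithin).exists
        have hst : s < t := hst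
        have := hp (X.pt e s)
        rw [htp] at hs
        nlinarith
      refine ⟨h0, fun hex => ?_⟩
      -- With slope `0` the function would stay at its maximum just before `t`, so `t` would not be
      -- an exit. An integer slope that is nonnegative and nonzero is at least `1`.
      have hne : k ≠ 0 := by
        rintro rfl
        obtain ⟨s, hs, hst⟩ := (hk.and hex.2.2).exists
        exact hst (by simpa [htp] using hs)
      have h0' : 0 ≤ k := by exact_mod_cast h0
      exact_mod_cast (by omega : 1 ≤ k)
    exact finsum_mem_ge_ncard (X.finite_fiber_Ioc p e) (fun t ht => ⟨ht.1.1, ht.2⟩)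
      (fun t ht => (key t ht.1 ht.2).1) (fun t ht => (key t ht.1.1 ht.2).2 ht.1)
  have hR : ({t ∈ X.exitsRight {q | f q = f p} e | X.pt e t = p}.ncard : ℝ) ≤
      -∑ᶠ t ∈ {t : ℝ | t ∈ Ico 0 (X.len e) ∧ X.pt e t = p}, X.slopeAfter f e t := by
    have key : ∀ t, t ∈ Ico 0 (X.len e) → X.pt e t = p → 0 ≤ -X.slopeAfter f e t ∧
        (t ∈ X.exitsRight {q | f q = f p} e → 1 ≤ -X.slopeAfter f e t) := by
      intro t ht htp
      obtain ⟨k, hk⟩ := hf.exists_slopeAfter ht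
      rw [slopeAfter_eq hk]
      have h0 : (k : ℝ) ≤ 0 := by
        obtain ⟨s, hs, hst⟩ := (hk.and self_mem_nhdsWithin).exists
        have hst : t < s := hst
        have := hp (X.pt e s)
        rw [htp] at hs
        nlinarith
      refine ⟨by linarith, fun hex => ?_⟩
      have hne : k ≠ 0 := by
        rintro rfl
        obtain ⟨s, hs, hst⟩ := (hk.and hex.2.2).exists
        exact hst (by simpa [htp] using hs)
      have h0' : k ≤ 0 := by exact_mod_cast h0
      exact_mod_cast (by omega : 1 ≤ -k)
    rw [← finsum_mem_neg_distrib _ (X.finite_fiber_Ico p e)]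
    exact finsum_mem_ge_ncard (X.finite_fiber_Ico p e) (fun t ht => ⟨ht.1.1, ht.2⟩)
      (fun t ht => (key t ht.1 ht.2).1) (fun t ht => (key t ht.1.1 ht.2).2 ht.1)
  push_cast
  linarith

/-- The degree of `div f` on the locus where `f` is maximal. -/
theorem IsRational.delta_le_degOn {f : X.Point → ℝ} (hf : X.IsRational f) {D : X.Divisor}
    (hD : ∀ p, (D p : ℝ) = X.ord f p) {M : ℝ} (hM : ∀ q, f q ≤ M) :
    (X.delta {p | f p = M} : ℤ) ≤ degOn {p | f p = M} D := by
  classical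
  set Y : Set X.Point := {p | f p = M} with hYdef
  have hY : X.IsSubcurve Y := hf.isSubcurve_level M
  set R : X.E → Finset ℝ := fun e => (hY.finite_exitsRight e).toFinset
  set L : X.E → Finset ℝ := fun e => (hY.finite_exitsLeft e).toFinset
  set F : Finset X.Point := D.support ∪ Finset.univ.biUnion
    (fun e => (R e ∪ L e).image (X.pt e)) with hF
  -- The exits are regrouped by the point at which they occur, so that the claim becomes the
  -- pointwise bound `IsRational.card_exits_le_ord`.
  have hcount : X.delta Y = ∑ p ∈ F, ∑ e : X.E, ({t ∈ X.exitsRight Y e | X.pt e t = p}.ncard +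
      {t ∈ X.exitsLeft Y e | X.pt e t = p}.ncard) := by
    rw [delta_eq, Finset.sum_comm]
    refine Finset.sum_congr rfl fun e _ => ?_
    rw [Finset.sum_add_distrib]
    have hmem : ∀ t ∈ R e ∪ L e, X.pt e t ∈ F := fun t ht => by
      rw [hF]
      exact Finset.mem_union_right _
        (Finset.mem_biUnion.2 ⟨e, Finset.mem_univ _, Finset.mem_image_of_mem _ ht⟩)
    congr 1
    · rw [Set.ncard_eq_toFinset_card _ (hY.finite_exitsRight e),
        Finset.card_eq_sum_card_fiberwise (f := X.pt e) (t := F)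
          fun t ht => hmem t (Finset.mem_union_left _ ht)]
      refine Finset.sum_congr rfl fun p _ => ?_
      rw [← Set.ncard_coe_finset]
      congr 1
      ext t
      simp [R]
    · rw [Set.ncard_eq_toFinset_card _ (hY.finite_exitsLeft e),
        Finset.card_eq_sum_card_fiberwise (f := X.pt e) (t := F)
          fun t ht => hmem t (Finset.mem_union_right _ ht)]
      refine Finset.sum_congr rfl fun p _ => ?_
      rw [← Set.ncard_coe_finset]
      congr 1
      ext t
      simp [L]
  rw [degOn_eq_sum (F := F) Finset.subset_union_left, hcount, Nat.cast_sum]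
  refine Finset.sum_le_sum fun p _ => ?_
  by_cases hp : p ∈ Y
  · rw [Set.indicator_of_mem hp]
    have hpM : f p = M := hp
    have := hf.card_exits_le_ord (p := p) fun q => (hM q).trans hpM.ge
    rw [hpM, ← hD] at this
    exact_mod_cast this
  · rw [Set.indicator_of_notMem hp]
    have h1 : ∀ e, {t ∈ X.exitsRight Y e | X.pt e t = p} = ∅ := fun e =>
      Set.eq_empty_of_forall_notMem fun t ht => hp (ht.2 ▸ ht.1.2.1)
    have h2 : ∀ e, {t ∈ X.exitsLeft Y e | X.pt e t = p} = ∅ := fun e =>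
      Set.eq_empty_of_forall_notMem fun t ht => hp (ht.2 ▸ ht.1.2.1)
    simp [h1, h2]

theorem ord_const (c : ℝ) (p : X.Point) : X.ord (fun _ => c) p = 0 := by
  simp [ord, slopeBefore, slopeAfter]

/-! ### Uniqueness -/

/-- Equivalent quasistable divisors of the same degree are equal. -/
theorem IsQuasistable.eq_of_isPrincipal_sub {p₀ : X.Point} {d : ℤ} {μ : X.Point →₀ ℝ}
    (hμ : X.IsPolarization μ d) {D₁ D₂ : X.Divisor} (hd₁ : X.deg D₁ = d)
    (h₁ : X.IsQuasistable p₀ μ D₁) (h₂ : X.IsQuasistable p₀ μ D₂)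
    (h : X.IsPrincipal (D₁ - D₂)) : D₁ = D₂ := by
  classical
  obtain ⟨f, hf, hfD⟩ := h
  obtain ⟨q, hq⟩ := exists_forall_le hf.1
  set Y : Set X.Point := {p | f p = f q} with hYdef
  by_cases hYu : Y = univ
  · have hconst : f = fun _ => f q := funext fun p => by
      have : p ∈ Y := hYu ▸ mem_univ p
      exact this
    rw [← sub_eq_zero]
    ext p
    have := hfD p
    rw [hconst, ord_const] at this
    exact_mod_cast this
  exfalso
  have hY : X.IsSubcurve Y := hf.isSubcurve_level _
  obtain ⟨Z, hZ, hYZ, hPZ, hδ⟩ := hY.exists_compl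
    (P := ((insert p₀ (D₁.support ∪ μ.support) : Finset X.Point) : Set X.Point))
    (Finset.finite_toSet _)
  have hZu : Z ≠ univ := by
    rintro rfl
    exact Set.disjoint_left.1 hYZ (show q ∈ Y from rfl) (mem_univ q)
  have hle := hf.delta_le_degOn hfD hq
  rw [map_sub] at hle
  have hle' : (X.delta Y : ℝ) ≤ (degOn Y D₁ : ℤ) - (degOn Y D₂ : ℤ) := by exact_mod_cast hle
  have hδ' : (X.delta Z : ℝ) ≤ X.delta Y := by exact_mod_cast hδ
  have hD : degOn Y D₁ + degOn Z D₁ = d :=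
    (degOn_add_degOn hYZ fun p hp => hPZ (by simp at hp; simp [hp])).trans hd₁
  have hμ' : degOn Y μ + degOn Z μ = d :=
    (degOn_add_degOn hYZ fun p hp => hPZ (by simp at hp; simp [hp])).trans hμ
  have hD' : ((degOn Y D₁ : ℤ) : ℝ) + (degOn Z D₁ : ℤ) = d := by exact_mod_cast hD
  have b₁ := h₁.1 Z hZ
  have b₂ := h₂.1 Y hY
  rcases hPZ (show p₀ ∈ _ by simp) with h0 | h0
  · have := h₂.2 Y hY hYu h0
    rw [beta_eq] at this b₁
    linarith
  · have := h₁.2 Z hZ hZu h0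
    rw [beta_eq] at this b₂
    linarith

/-! ### Rational functions with prescribed slopes -/

/-- The function on the line that has slope `1` on `[a, b]` and is constant elsewhere. -/
def ramp (a b s : ℝ) : ℝ := max a (min s b) - a

theorem continuous_ramp (a b : ℝ) : Continuous (ramp a b) := by
  unfold ramp
  fun_prop

theorem isLinearOff_ramp {a b ℓ : ℝ} (hab : a ≤ b) {T : Finset ℝ} (ha : a ∈ T) (hb : b ∈ T) :
    IsLinearOff (ramp a b) ℓ T := by
  intro c d _ hcd _ hT
  have h1 := hT a ha
  have h2 := hT b hb
  rcases hcd.eq_or_lt with rfl | hcd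
  · exact ⟨0, fun s hs => by simp [le_antisymm hs.2 hs.1]⟩
  by_cases h : a ≤ c ∧ d ≤ b
  · refine ⟨1, fun s hs => ?_⟩
    simp only [ramp]
    rw [min_eq_left (hs.2.trans h.2), max_eq_right (h.1.trans hs.1), min_eq_left (hcd.le.trans h.2),
      max_eq_right h.1]
    push_cast
    ring
  · refine ⟨0, fun s hs => ?_⟩
    simp only [mem_Ioo, not_and, not_lt, mem_Icc] at h1 h2 hs h
    simp only [ramp, max_def, min_def]
    grind

theorem ramp_before {a b : ℝ} (hab : a ≤ b) (t : ℝ) :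
    ∀ᶠ s in 𝓝[<] t, ramp a b s = ramp a b t + (Ioc a b).indicator 1 t * (s - t) := by
  by_cases h : t ∈ Ioc a b
  · filter_upwards [Ioo_mem_nhdsLT h.1] with s hs
    rw [Set.indicator_of_mem h]
    simp only [ramp]
    rw [min_eq_left (hs.2.le.trans h.2), max_eq_right hs.1.le, min_eq_left h.2,
      max_eq_right h.1.le]
    simp
  · rw [Set.indicator_of_notMem h]
    rcases le_or_gt t a with hta | hta
    · filter_upwards [self_mem_nhdsWithin] with s hs
      have hs : s < t := hs
      simp only [ramp, max_def, min_def]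
      grind
    · have hbt : b < t := by
        by_contra! hn
        exact h ⟨hta, hn⟩
      filter_upwards [Ioo_mem_nhdsLT hbt] with s hs
      simp only [ramp]
      rw [min_eq_right hs.1.le, min_eq_right hbt.le]
      simp

theorem ramp_after {a b : ℝ} (hab : a ≤ b) (t : ℝ) :
    ∀ᶠ s in 𝓝[>] t, ramp a b s = ramp a b t + (Ico a b).indicator 1 t * (s - t) := by
  by_cases h : t ∈ Ico a b
  · filter_upwards [Ioo_mem_nhdsGT h.2] with s hs
    rw [Set.indicator_of_mem h]
    simp only [ramp]
    rw [min_eq_left hs.2.le, max_eq_right (h.1.trans hs.1.le), min_eq_left h.2.le,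
      max_eq_right h.1]
    simp
  · rw [Set.indicator_of_notMem h]
    rcases lt_or_ge t a with hta | hta
    · filter_upwards [Ioo_mem_nhdsGT hta] with s hs
      have hs := hs.2
      simp only [ramp, max_def, min_def]
      grind
    · have hbt : b ≤ t := by
        by_contra! hn
        exact h ⟨hta, hn⟩
      filter_upwards [self_mem_nhdsWithin] with s hs
      have hs : t < s := hs
      simp only [ramp]
      rw [min_eq_right (hbt.trans hs.le), min_eq_right hbt]
      simp

/-- Slope before `t` minus slope after `t` for `ramp a b`: its divisor is `b - a`. -/
theorem indicator_Ioc_sub_indicator_Ico {a b : ℝ} (hab : a ≤ b) (t : ℝ) :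
    (Ioc a b).indicator (1 : ℝ → ℝ) t - (Ico a b).indicator 1 t =
      (if b = t then 1 else 0) - if a = t then 1 else 0 := by
  simp only [Set.indicator_apply, mem_Ioc, mem_Ico, Pi.one_apply]
  grind

/-- Used to write the two sums in `ord`, over parameters in `Ioc` and in `Ico`, as sums over the
same finite fiber; the slope formulas vanish at the end of the edge that is added. -/
theorem finsum_mem_eq_sum_of_subset_toFinset {A B : Set ℝ} (hA : A.Finite) (hBA : B ⊆ A)
    {f g : ℝ → ℝ} (hfg : ∀ t ∈ B, f t = g t) (h0 : ∀ t ∈ A, t ∉ B → g t = 0) :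
    ∑ᶠ t ∈ B, f t = ∑ t ∈ hA.toFinset, g t := by
  rw [finsum_mem_congr rfl hfg, finsum_mem_eq_finite_toFinset_sum _ (hA.subset hBA)]
  exact Finset.sum_subset (fun t ht => by simp at ht ⊢; exact hBA ht)
    fun t ht ht' => h0 t (by simpa using ht) (by simpa using ht')

section Slopes

variable {κ : Type*} [Fintype κ] [DecidableEq X.E] (ed : κ → X.E) (a b : κ → ℝ) (k : κ → ℤ)
  (h : X.V → ℝ)

/-- The function on the edge `e` with initial value `h (src e)` that has slope `k j` on the
interval `[a j, b j]`, slopes being added on overlaps. -/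
def edgeFun (e : X.E) (s : ℝ) : ℝ :=
  h (X.src e) + ∑ j with ed j = e, k j * ramp (a j) (b j) s

/-- The function on `X` that is `h` on the vertices and `edgeFun` on the edges. -/
def pointFun : X.Point → ℝ
  | .vertex w => h w
  | .interior e t _ _ => edgeFun ed a b k h e t

variable {ed a b k h}
variable (hab : ∀ j, 0 ≤ a j ∧ a j ≤ b j ∧ b j ≤ X.len (ed j))
  (hh : ∀ e, ∑ j with ed j = e, k j * (b j - a j) = h (X.tgt e) - h (X.src e))

-- The hypothesis `hh` says that the increments of the ramps on `e` add up to the difference of the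
-- prescribed values at its ends, so the edge functions glue at the vertices.
include hab hh in
theorem pointFun_pt {e : X.E} {s : ℝ} (hs : s ∈ Icc 0 (X.len e)) :
    pointFun ed a b k h (X.pt e s) = edgeFun ed a b k h e s := by
  rcases hs.1.eq_or_lt with rfl | h0
  · rw [pt_zero]
    simp only [pointFun, edgeFun, left_eq_add]
    refine Finset.sum_eq_zero fun j _ => ?_
    rw [ramp, max_eq_left ((min_le_left _ _).trans (hab j).1), sub_self, mul_zero]
  rcases hs.2.eq_or_lt with rfl | h1
  · rw [pt_len]
    simp only [pointFun, edgeFun]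
    rw [← sub_eq_iff_eq_add', ← hh]
    refine Finset.sum_congr rfl fun j hj => ?_
    have hj : ed j = e := by simpa using hj
    rw [ramp, min_eq_right (hj ▸ (hab j).2.2), max_eq_right (hab j).2.1]
  · rw [X.pt_of_mem_Ioo ⟨h0, h1⟩, pointFun]

include hab hh in
theorem isRational_pointFun : X.IsRational (pointFun ed a b k h) := by
  classical
  refine isRational_iff.2 ⟨?_, fun e => ⟨Finset.univ.image a ∪ Finset.univ.image b, ?_⟩⟩
  · refine continuous_iSup_dom.2 fun e => continuous_coinduced_dom.2 ?_
    have : (pointFun ed a b k h ∘ fun t : Icc (0 : ℝ) (X.len e) => X.pt e t) =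
        fun t : Icc (0 : ℝ) (X.len e) => edgeFun ed a b k h e t := funext fun t => pointFun_pt hab hh t.2
    rw [this]
    refine continuous_const.add (continuous_finsetSum _ fun j _ => continuous_const.mul ?_)
    exact (continuous_ramp _ _).comp continuous_subtype_val
  · intro c d hc hcd hd hT
    have key : ∀ j, ∃ m : ℤ, ∀ s ∈ Icc c d,
        ramp (a j) (b j) s = ramp (a j) (b j) c + m * (s - c) := fun j =>
      isLinearOff_ramp (hab j).2.1
        (Finset.mem_union_left _ (Finset.mem_image_of_mem a (Finset.mem_univ j)))
        (Finset.mem_union_right _ (Finset.mem_image_of_mem b (Finset.mem_univ j))) c d hc hcd hd hT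
    choose m hm using key
    refine ⟨∑ j with ed j = e, k j * m j, fun s hs => ?_⟩
    simp only
    rw [pointFun_pt hab hh ⟨hc.trans hs.1, hs.2.trans hd⟩, pointFun_pt hab hh ⟨hc, hcd.trans hd⟩,
      edgeFun, edgeFun, add_assoc]
    push_cast
    rw [Finset.sum_mul, ← Finset.sum_add_distrib]
    refine congrArg _ (Finset.sum_congr rfl fun j _ => ?_)
    rw [hm j s hs]
    ring

include hab hh in
theorem slopeBefore_pointFun {e : X.E} {t : ℝ} (ht : t ∈ Ioc 0 (X.len e)) :
    X.slopeBefore (pointFun ed a b k h) e t =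
      ∑ j with ed j = e, k j * (Ioc (a j) (b j)).indicator (1 : ℝ → ℝ) t := by
  refine slopeBefore_eq ?_
  have hev := eventually_all.2 fun j => ramp_before (hab j).2.1 t
  filter_upwards [hev, Ioo_mem_nhdsLT ht.1] with s hs hst
  rw [pointFun_pt hab hh ⟨ht.1.le, ht.2⟩, pointFun_pt hab hh ⟨hst.1.le, hst.2.le.trans ht.2⟩,
    edgeFun, edgeFun, add_assoc, Finset.sum_mul, ← Finset.sum_add_distrib]
  refine congrArg _ (Finset.sum_congr rfl fun j _ => ?_)
  rw [hs j]
  ring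

include hab hh in
theorem slopeAfter_pointFun {e : X.E} {t : ℝ} (ht : t ∈ Ico 0 (X.len e)) :
    X.slopeAfter (pointFun ed a b k h) e t =
      ∑ j with ed j = e, k j * (Ico (a j) (b j)).indicator (1 : ℝ → ℝ) t := by
  refine slopeAfter_eq ?_
  have hev := eventually_all.2 fun j => ramp_after (hab j).2.1 t
  filter_upwards [hev, Ioo_mem_nhdsGT ht.2] with s hs hst
  rw [pointFun_pt hab hh ⟨ht.1, ht.2.le⟩, pointFun_pt hab hh ⟨ht.1.trans hst.1.le, hst.2.le⟩,
    edgeFun, edgeFun, add_assoc, Finset.sum_mul, ← Finset.sum_add_distrib]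
  refine congrArg _ (Finset.sum_congr rfl fun j _ => ?_)
  rw [hs j]
  ring

include hab hh in
/-- The divisor of a rational function with prescribed slopes. -/
theorem isPrincipal_of_slopes :
    X.IsPrincipal (∑ j, k j • (Finsupp.single (X.pt (ed j) (b j)) 1 -
      Finsupp.single (X.pt (ed j) (a j)) 1)) := by
  classical
  refine ⟨pointFun ed a b k h, isRational_pointFun hab hh, fun p => ?_⟩
  unfold ord
  rw [Finsupp.finsetSum_apply, ← Finset.sum_fiberwise Finset.univ ed]
  push_cast
  refine Finset.sum_congr rfl fun e _ => ?_
  have hL : ∑ᶠ t ∈ {t : ℝ | t ∈ Ioc 0 (X.len e) ∧ X.pt e t = p},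
      X.slopeBefore (pointFun ed a b k h) e t = ∑ t ∈ (X.finite_fiber p e).toFinset,
        ∑ j with ed j = e, k j * (Ioc (a j) (b j)).indicator (1 : ℝ → ℝ) t := by
    refine finsum_mem_eq_sum_of_subset_toFinset (X.finite_fiber p e) (fun t ht => ⟨⟨ht.1.1.le, ht.1.2⟩, ht.2⟩)
      (fun t ht => slopeBefore_pointFun hab hh ht.1) fun t ht ht' => ?_
    refine Finset.sum_eq_zero fun j _ => ?_
    rw [Set.indicator_of_notMem, mul_zero]
    exact fun hj => ht' ⟨⟨(hab j).1.trans_lt hj.1, ht.1.2⟩, ht.2⟩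
  have hR : ∑ᶠ t ∈ {t : ℝ | t ∈ Ico 0 (X.len e) ∧ X.pt e t = p},
      X.slopeAfter (pointFun ed a b k h) e t = ∑ t ∈ (X.finite_fiber p e).toFinset,
        ∑ j with ed j = e, k j * (Ico (a j) (b j)).indicator (1 : ℝ → ℝ) t := by
    refine finsum_mem_eq_sum_of_subset_toFinset (X.finite_fiber p e) (fun t ht => ⟨⟨ht.1.1, ht.1.2.le⟩, ht.2⟩)
      (fun t ht => slopeAfter_pointFun hab hh ht.1) fun t ht ht' => ?_
    refine Finset.sum_eq_zero fun j hj' => ?_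
    have hj' : ed j = e := by simpa using hj'
    rw [Set.indicator_of_notMem, mul_zero]
    exact fun hj => ht' ⟨⟨ht.1.1, hj.2.trans_le (hj' ▸ (hab j).2.2)⟩, ht.2⟩
  rw [hL, hR, ← Finset.sum_sub_distrib]
  simp_rw [← Finset.sum_sub_distrib, ← mul_sub]
  rw [Finset.sum_comm]
  refine Finset.sum_congr rfl fun j hj => ?_
  have hj : ed j = e := by simpa using hj
  rw [← Finset.mul_sum, Finset.sum_congr rfl fun t _ =>
    indicator_Ioc_sub_indicator_Ico (hab j).2.1 t, Finset.sum_sub_distrib, Finset.sum_ite_eq,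
    Finset.sum_ite_eq]
  have hb : b j ∈ (X.finite_fiber p e).toFinset ↔ X.pt e (b j) = p := by
    simp only [Finite.mem_toFinset]
    exact and_iff_right ⟨(hab j).1.trans (hab j).2.1, hj ▸ (hab j).2.2⟩
  have ha : a j ∈ (X.finite_fiber p e).toFinset ↔ X.pt e (a j) = p := by
    simp only [Finite.mem_toFinset]
    exact and_iff_right ⟨(hab j).1, (hab j).2.1.trans (hj ▸ (hab j).2.2)⟩
  simp only [hb, ha, hj, Pi.smul_apply, Pi.sub_apply, Finsupp.single_apply, smul_eq_mul]
  push_cast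
  rfl

end Slopes

/-! ### A convex piecewise linear energy on finite graphs -/

/-- The convex piecewise linear function that interpolates `x ^ 2 / 2` at the integers. -/
noncomputable def squareInterp (x : ℝ) : ℝ := (x ^ 2 + Int.fract x * (1 - Int.fract x)) / 2

theorem squareInterp_zero : squareInterp 0 = 0 := by simp [squareInterp]

theorem continuous_squareInterp : Continuous squareInterp := by
  have h : Continuous ((fun y : ℝ => y * (1 - y)) ∘ Int.fract) :=
    -- `y * (1 - y)` takes the same value at `0` and `1`, so the jumps of `Int.fract` are not seen.
    ContinuousOn.comp_fract'' (Continuous.continuousOn (by fun_prop)) (by simp)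
  exact ((continuous_pow 2).add h).div_const 2

theorem sq_le_squareInterp (x : ℝ) : x ^ 2 / 2 ≤ squareInterp x := by
  have h0 := Int.fract_nonneg x
  have h1 := Int.fract_lt_one x
  have := mul_nonneg h0 (sub_nonneg.2 h1.le)
  unfold squareInterp
  linarith

/-- The slope `m + 1/2` between consecutive integers is what produces the term `δ_Y / 2` of `β`. -/
theorem squareInterp_eq {x : ℝ} {m : ℤ} (hx : x ∈ Icc (m : ℝ) (m + 1)) :
    squareInterp x = (m + 1 / 2) * x - m * (m + 1) / 2 := by
  unfold squareInterp
  rcases hx.2.lt_or_eq with h | rfl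
  · have hm : ⌊x⌋ = m := Int.floor_eq_iff.2 ⟨hx.1, h⟩
    rw [Int.fract, hm]
    ring
  · have : Int.fract ((m : ℝ) + 1) = 0 := by
      simp
    rw [this]
    ring

section Energy

variable {ι κ : Type*} [Fintype ι] [Fintype κ] (a b : κ → ι) (ℓ : κ → ℝ) (c : ι → ℝ)

/-- The energy of a function on the nodes of a finite graph with edges `κ` of lengths `ℓ`, with a
linear term given by `c`. -/
noncomputable def energy (φ : ι → ℝ) : ℝ :=
  ∑ k, ℓ k * squareInterp ((φ (b k) - φ (a k)) / ℓ k) + ∑ i, c i * φ i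

theorem continuous_energy : Continuous (energy a b ℓ c) := by
  unfold energy
  have := continuous_squareInterp
  fun_prop

variable {a b ℓ c}

theorem energy_add_const (hc : ∑ i, c i = 0) (φ : ι → ℝ) (r : ℝ) :
    energy a b ℓ c (fun i => φ i + r) = energy a b ℓ c φ := by
  simp only [energy, add_sub_add_right_eq_sub, mul_add, Finset.sum_add_distrib, ← Finset.sum_mul,
    hc, zero_mul, add_zero]

-- Along a chain of edges joining `i` to `j` the increments add up; `C` bounds how often an edge is
-- used.
omit [Fintype ι] in
theorem exists_abs_sub_le_of_eqvGen {i j : ι}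
    (h : Relation.EqvGen (fun i j => ∃ k, a k = i ∧ b k = j) i j) :
    ∃ C : ℝ, ∀ φ : ι → ℝ, |φ i - φ j| ≤ C * ∑ k, |φ (b k) - φ (a k)| := by
  induction h with
  | rel i j h =>
    obtain ⟨k, rfl, rfl⟩ := h
    refine ⟨1, fun φ => ?_⟩
    rw [one_mul, abs_sub_comm]
    exact Finset.single_le_sum (f := fun k => |φ (b k) - φ (a k)|) (fun _ _ => abs_nonneg _)
      (Finset.mem_univ k)
  | refl i => exact ⟨0, fun φ => by simp⟩
  | symm i j _ ih =>
    obtain ⟨C, hC⟩ := ih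
    exact ⟨C, fun φ => by rw [abs_sub_comm]; exact hC φ⟩
  | trans i j l _ _ ih₁ ih₂ =>
    obtain ⟨C₁, h₁⟩ := ih₁
    obtain ⟨C₂, h₂⟩ := ih₂
    refine ⟨C₁ + C₂, fun φ => ?_⟩
    rw [add_mul]
    exact (abs_sub_le _ (φ j) _).trans (add_le_add (h₁ φ) (h₂ φ))

/-- The energy is coercive on the functions that vanish at a given node. -/
theorem exists_bound_of_energy_nonpos (hℓ : ∀ k, 0 < ℓ k) (i₀ : ι)
    (hconn : ∀ i, Relation.EqvGen (fun i j => ∃ k, a k = i ∧ b k = j) i i₀) :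
    ∃ B, ∀ φ : ι → ℝ, φ i₀ = 0 → energy a b ℓ c φ ≤ 0 → ∀ i, |φ i| ≤ B := by
  choose C hC using fun i => exists_abs_sub_le_of_eqvGen (hconn i)
  set K : ℝ := ∑ i, |c i| * |C i| with hK
  set K' : ℝ := ∑ i, |C i| with hK'
  have hK0 : 0 ≤ K := Finset.sum_nonneg fun i _ => by positivity
  refine ⟨K' * ∑ k, (K + 1) ^ 2 * ℓ k / 2, fun φ h0 hE i => ?_⟩
  set s : ℝ := ∑ k, |φ (b k) - φ (a k)| with hs
  have hs0 : 0 ≤ s := Finset.sum_nonneg fun _ _ => abs_nonneg _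
  have hφ : ∀ i, |φ i| ≤ |C i| * s := fun i => by
    have := hC i φ
    rw [h0, sub_zero] at this
    exact this.trans (mul_le_mul_of_nonneg_right (le_abs_self _) hs0)
  have h1 : -(K * s) ≤ ∑ i, c i * φ i := by
    rw [hK, Finset.sum_mul, ← Finset.sum_neg_distrib]
    refine Finset.sum_le_sum fun i _ => ?_
    have h2 := neg_abs_le (c i * φ i)
    have h3 := mul_le_mul_of_nonneg_left (hφ i) (abs_nonneg (c i))
    rw [abs_mul] at h2
    linarith
  -- Termwise `(K + 1) |x| ≤ x² / (2ℓ) + (K + 1)² ℓ / 2`. The factor `K + 1` beats the linear term,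
  -- which is at least `-K s`, by exactly `s`.
  have h2 : (K + 1) * s - ∑ k, (K + 1) ^ 2 * ℓ k / 2 ≤
      ∑ k, ℓ k * squareInterp ((φ (b k) - φ (a k)) / ℓ k) := by
    rw [hs, Finset.mul_sum, ← Finset.sum_sub_distrib]
    refine Finset.sum_le_sum fun k _ => ?_
    refine le_trans ?_ (mul_le_mul_of_nonneg_left (sq_le_squareInterp _) (hℓ k).le)
    set x := φ (b k) - φ (a k)
    have hk := hℓ k
    have h4 : ℓ k * ((x / ℓ k) ^ 2 / 2) - ((K + 1) * |x| - (K + 1) ^ 2 * ℓ k / 2) =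
        (|x| - (K + 1) * ℓ k) ^ 2 / (2 * ℓ k) := by
      field_simp
      rw [← sq_abs x]
      ring
    have h5 : 0 ≤ (|x| - (K + 1) * ℓ k) ^ 2 / (2 * ℓ k) := by positivity
    linarith
  unfold energy at hE
  have hsB : s ≤ ∑ k, (K + 1) ^ 2 * ℓ k / 2 := by linarith
  refine (hφ i).trans (mul_le_mul ?_ hsB hs0 (Finset.sum_nonneg fun _ _ => abs_nonneg _))
  exact Finset.single_le_sum (f := fun i => |C i|) (fun _ _ => abs_nonneg _) (Finset.mem_univ i)

open Classical in
/-- A minimizer of the energy that cannot be moved up on any set `S ≠ univ` containing `i₀`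
without changing the energy. -/
theorem exists_energy_minimizer (hℓ : ∀ k, 0 < ℓ k) (hc : ∑ i, c i = 0) (i₀ : ι)
    (hconn : ∀ i, Relation.EqvGen (fun i j => ∃ k, a k = i ∧ b k = j) i i₀) :
    ∃ φ : ι → ℝ, ∀ (S : Set ι) (ε : ℝ), 0 < ε →
      energy a b ℓ c φ ≤ energy a b ℓ c (fun i => φ i + S.indicator (fun _ => ε) i) ∧
      (i₀ ∈ S → S ≠ univ →
        energy a b ℓ c φ < energy a b ℓ c (fun i => φ i + S.indicator (fun _ => ε) i)) := by
  set E := energy a b ℓ c with hE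
  have hEc : Continuous E := continuous_energy a b ℓ c
  obtain ⟨B, hB⟩ := exists_bound_of_energy_nonpos (c := c) hℓ i₀ hconn
  have h00 : E 0 = 0 := by simp [hE, energy, squareInterp_zero]
  have hcpt : IsCompact {φ : ι → ℝ | φ i₀ = 0 ∧ E φ ≤ 0} := by
    refine (isCompact_univ_pi fun _ : ι => isCompact_Icc (a := -B) (b := B)).of_isClosed_subset
      ((isClosed_eq (continuous_apply i₀) continuous_const).inter
        (isClosed_le hEc continuous_const)) ?_
    rintro φ ⟨h1, h2⟩ i -
    exact abs_le.1 (hB φ h1 h2 i)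
  obtain ⟨φ₀, hφ₀, hmin₀⟩ := hcpt.exists_isMinOn ⟨0, rfl, h00.le⟩ hEc.continuousOn
  have hmin : ∀ ψ, E φ₀ ≤ E ψ := by
    intro ψ
    have hshift : E (fun i => ψ i + -ψ i₀) = E ψ := energy_add_const hc ψ _
    by_cases hψ : E ψ ≤ 0
    · rw [← hshift]
      exact hmin₀ ⟨by simp, by rw [hshift]; exact hψ⟩
    · exact hφ₀.2.trans (not_le.1 hψ).le
  have hcpt' : IsCompact ({φ : ι → ℝ | φ i₀ = 0 ∧ E φ ≤ 0} ∩ {φ | E φ ≤ E φ₀}) :=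
    hcpt.inter_right (isClosed_le hEc continuous_const)
  -- Second minimization: the least sum of values among the minimizers that vanish at `i₀`.
  obtain ⟨φ, ⟨⟨hφ0, hφE⟩, hφm⟩, hsum⟩ := hcpt'.exists_isMinOn (f := fun φ : ι → ℝ => ∑ i, φ i)
    ⟨φ₀, hφ₀, le_refl (E φ₀)⟩ (by fun_prop)
  have hφm : E φ ≤ E φ₀ := hφm
  refine ⟨φ, fun S ε hε => ⟨hφm.trans (hmin _), fun hi hS => ?_⟩⟩
  refine lt_of_le_of_ne (hφm.trans (hmin _)) fun heq => ?_
  set ψ : ι → ℝ := fun i => φ i + S.indicator (fun _ => ε) i with hψ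
  have hshift : E (fun i => ψ i + -ε) = E ψ := energy_add_const hc ψ _
  -- As `i₀ ∈ S`, subtracting `ε` restores the value `0` at `i₀`. The net effect is to lower `φ` by
  -- `ε` off `S`.
  have h1 : ∑ i, φ i ≤ ∑ i, (ψ i + -ε) := hsum (show (fun i => ψ i + -ε) ∈ _ from
    ⟨⟨by simp [hψ, hi, hφ0], by rw [hshift, ← heq]; exact hφE⟩,
      by show E _ ≤ _; rw [hshift, ← heq]; exact hφm⟩)
  obtain ⟨j, hj⟩ := (Set.ne_univ_iff_exists_notMem S).1 hS
  refine absurd h1 (not_le.2 (Finset.sum_lt_sum (fun i _ => ?_) ⟨j, Finset.mem_univ j, ?_⟩))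
  · by_cases hiS : i ∈ S <;> simp [hψ, hiS, hε.le]
  · simp [hψ, hj, hε]

end Energy

/-! ### Local estimates on a segment -/

theorem squareInterp_add {ℓ Δ : ℝ} (hℓ : 0 < ℓ) : ∀ᶠ ε in 𝓝[>] (0 : ℝ),
    ℓ * squareInterp ((Δ + ε) / ℓ) = ℓ * squareInterp (Δ / ℓ) + ε * (⌊Δ / ℓ⌋ + 1 / 2) := by
  have h1 := Int.floor_le (Δ / ℓ)
  have h2 := Int.lt_floor_add_one (Δ / ℓ)
  rw [div_lt_iff₀ hℓ] at h2
  have h1' := (le_div_iff₀ hℓ).1 h1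
  filter_upwards [Ioo_mem_nhdsGT (show 0 < (⌊Δ / ℓ⌋ + 1) * ℓ - Δ by linarith)] with ε hε
  rw [squareInterp_eq (m := ⌊Δ / ℓ⌋) (x := Δ / ℓ) ⟨h1, (Int.lt_floor_add_one _).le⟩,
    squareInterp_eq (m := ⌊Δ / ℓ⌋) (x := (Δ + ε) / ℓ)
      ⟨by rw [le_div_iff₀ hℓ]; linarith [hε.1], by rw [div_le_iff₀ hℓ]; linarith [hε.2]⟩]
  field_simp
  ring

theorem squareInterp_sub {ℓ Δ : ℝ} (hℓ : 0 < ℓ) (h : ⌊Δ / ℓ⌋ * ℓ < Δ) : ∀ᶠ ε in 𝓝[>] (0 : ℝ),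
    ℓ * squareInterp ((Δ - ε) / ℓ) = ℓ * squareInterp (Δ / ℓ) - ε * (⌊Δ / ℓ⌋ + 1 / 2) := by
  have h2 := Int.lt_floor_add_one (Δ / ℓ)
  rw [div_lt_iff₀ hℓ] at h2
  filter_upwards [Ioo_mem_nhdsGT (show 0 < Δ - ⌊Δ / ℓ⌋ * ℓ by linarith)] with ε hε
  rw [squareInterp_eq (m := ⌊Δ / ℓ⌋) (x := Δ / ℓ) ⟨Int.floor_le _, (Int.lt_floor_add_one _).le⟩,
    squareInterp_eq (m := ⌊Δ / ℓ⌋) (x := (Δ - ε) / ℓ)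
      ⟨by rw [le_div_iff₀ hℓ]; linarith [hε.2], by rw [div_le_iff₀ hℓ]; linarith [hε.1]⟩]
  field_simp
  ring

/-- At an integer slope the left derivative belongs to the previous piece. This is the case in which
the break point is the right end of the segment. -/
theorem squareInterp_sub_of_eq {ℓ Δ : ℝ} (hℓ : 0 < ℓ) (h : ⌊Δ / ℓ⌋ * ℓ = Δ) :
    ∀ᶠ ε in 𝓝[>] (0 : ℝ),
      ℓ * squareInterp ((Δ - ε) / ℓ) = ℓ * squareInterp (Δ / ℓ) - ε * (⌊Δ / ℓ⌋ - 1 / 2) := by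
  filter_upwards [Ioo_mem_nhdsGT hℓ] with ε hε
  rw [squareInterp_eq (m := ⌊Δ / ℓ⌋) (x := Δ / ℓ) ⟨Int.floor_le _, (Int.lt_floor_add_one _).le⟩,
    squareInterp_eq (m := ⌊Δ / ℓ⌋ - 1) (x := (Δ - ε) / ℓ)
      ⟨by rw [le_div_iff₀ hℓ]; push_cast; linarith [hε.2],
        by rw [div_le_iff₀ hℓ]; push_cast; linarith [hε.1]⟩]
  have h' : (⌊Δ / ℓ⌋ : ℝ) = Δ / ℓ := by field_simp; linarith
  push_cast
  generalize (⌊Δ / ℓ⌋ : ℝ) = m at h h'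
  subst h
  field_simp
  ring

/-- The parameter at which the function on `[a, b]` with increment `Δ` and slopes `⌊Δ / (b - a)⌋`,
`⌊Δ / (b - a)⌋ + 1` changes its slope. -/
noncomputable def breakPoint (a b Δ : ℝ) : ℝ := b - (Δ - ⌊Δ / (b - a)⌋ * (b - a))

theorem breakPoint_mem {a b : ℝ} (hab : a < b) (Δ : ℝ) : breakPoint a b Δ ∈ Ioc a b := by
  have hℓ : 0 < b - a := sub_pos.2 hab
  have h1 := (le_div_iff₀ hℓ).1 (Int.floor_le (Δ / (b - a)))
  have h2 := (div_lt_iff₀ hℓ).1 (Int.lt_floor_add_one (Δ / (b - a)))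
  unfold breakPoint
  constructor <;> linarith

open Classical in
/-- The contribution of the segment `[a, b]` of `e` to `β(Y)`. -/
noncomputable def segmentBeta (Y : Set X.Point) (e : X.E) (a b Δ : ℝ) : ℝ :=
  ⌊Δ / (b - a)⌋ * ((if X.pt e (breakPoint a b Δ) ∈ Y then 1 else 0) -
      if X.pt e a ∈ Y then 1 else 0) +
    (⌊Δ / (b - a)⌋ + 1) * ((if X.pt e b ∈ Y then 1 else 0) -
      if X.pt e (breakPoint a b Δ) ∈ Y then 1 else 0) +
    ((X.exitsRight Y e ∩ Ico a b).ncard + (X.exitsLeft Y e ∩ Ioc a b).ncard) / 2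

section Segment

variable {Y : Set X.Point} (hY : X.IsSubcurve Y) {e : X.E} {a b : ℝ} (ha : 0 ≤ a)
  (hab : a < b) (hb : b ≤ X.len e)

include hY in
theorem one_le_ncard_exitsRight {y z : ℝ} (hy : 0 ≤ y) (hay : a ≤ y) (hyz : y < z) (hzb : z ≤ b)
    (hb : b ≤ X.len e) (hyY : X.pt e y ∈ Y) (hzY : X.pt e z ∉ Y) :
    (1 : ℝ) ≤ (X.exitsRight Y e ∩ Ico a b).ncard := by
  obtain ⟨t, ht, hmem⟩ := hY.exists_exitRight hy (hzb.trans hb) hyz hyY hzY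
  have : (X.exitsRight Y e ∩ Ico a b).Nonempty :=
    ⟨t, ht, hay.trans hmem.1, hmem.2.trans_le hzb⟩
  exact_mod_cast (Set.ncard_pos ((hY.finite_exitsRight e).inter_of_left _)).2 this

include hY in
theorem one_le_ncard_exitsLeft {y z : ℝ} (hy : 0 ≤ y) (hay : a ≤ y) (hyz : y < z) (hzb : z ≤ b)
    (hb : b ≤ X.len e) (hyY : X.pt e y ∉ Y) (hzY : X.pt e z ∈ Y) :
    (1 : ℝ) ≤ (X.exitsLeft Y e ∩ Ioc a b).ncard := by
  obtain ⟨t, ht, hmem⟩ := hY.exists_exitLeft hy (hzb.trans hb) hyz hyY hzY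
  have : (X.exitsLeft Y e ∩ Ioc a b).Nonempty :=
    ⟨t, ht, hay.trans_lt hmem.1, hmem.2.trans hzb⟩
  exact_mod_cast (Set.ncard_pos ((hY.finite_exitsLeft e).inter_of_left _)).2 this

-- The local form of "derivative of the energy at most `β`". With `m = ⌊Δ / (b - a)⌋`, raising only
-- the end `b` costs `m + 1/2`, and an exit to the left pays for the half. Raising only `a` costs
-- `-(m + 1/2)`, or `-(m - 1/2)` if the slope is an integer; then the break point is `b ∉ Y`, which
-- supplies the missing `1`. If neither end is raised but the break point lies in `Y`, its degree
-- `-1` is offset by two exits.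
include hY ha hab hb in
open Classical in
theorem squareInterp_le_segmentBeta (Δ : ℝ) : ∀ᶠ ε in 𝓝[>] (0 : ℝ),
    (b - a) * squareInterp ((Δ + ((if X.pt e b ∈ Y then ε else 0) -
        if X.pt e a ∈ Y then ε else 0)) / (b - a)) ≤
      (b - a) * squareInterp (Δ / (b - a)) + ε * segmentBeta Y e a b Δ := by
  have hℓ : 0 < b - a := sub_pos.2 hab
  obtain ⟨hx1, hx2⟩ := breakPoint_mem hab Δ
  have hR0 : (0 : ℝ) ≤ (X.exitsRight Y e ∩ Ico a b).ncard := Nat.cast_nonneg _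
  have hL0 : (0 : ℝ) ≤ (X.exitsLeft Y e ∩ Ioc a b).ncard := Nat.cast_nonneg _
  by_cases haY : X.pt e a ∈ Y <;> by_cases hbY : X.pt e b ∈ Y <;>
    simp only [segmentBeta, haY, hbY, if_true, if_false]
  · filter_upwards [self_mem_nhdsWithin] with ε hε
    have hε : 0 < ε := hε
    rw [sub_self, add_zero, le_add_iff_nonneg_right]
    refine mul_nonneg hε.le ?_
    split_ifs <;> linarith
  · have hR := one_le_ncard_exitsRight hY (a := a) ha le_rfl hab le_rfl hb haY hbY
    rcases hx2.lt_or_eq with hlt | heq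
    · filter_upwards [squareInterp_sub (Δ := Δ) hℓ (by unfold breakPoint at hlt; linarith),
        self_mem_nhdsWithin] with ε h hε
      have hε : 0 < ε := hε
      rw [zero_sub, ← sub_eq_add_neg, h, sub_eq_add_neg, ← mul_neg]
      refine add_le_add_right (mul_le_mul_of_nonneg_left ?_ hε.le) _
      split_ifs <;> linarith
    · rw [heq]
      filter_upwards [squareInterp_sub_of_eq (Δ := Δ) hℓ (by unfold breakPoint at heq; linarith),
        self_mem_nhdsWithin] with ε h hε
      have hε : 0 < ε := hε
      rw [zero_sub, ← sub_eq_add_neg, h, sub_eq_add_neg, ← mul_neg, if_neg hbY]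
      refine add_le_add_right (mul_le_mul_of_nonneg_left ?_ hε.le) _
      linarith
  · have hL := one_le_ncard_exitsLeft hY (a := a) ha le_rfl hab le_rfl hb haY hbY
    filter_upwards [squareInterp_add (Δ := Δ) hℓ, self_mem_nhdsWithin] with ε h hε
    have hε : 0 < ε := hε
    rw [sub_zero, h]
    refine add_le_add_right (mul_le_mul_of_nonneg_left ?_ hε.le) _
    split_ifs <;> linarith
  · filter_upwards [self_mem_nhdsWithin] with ε hε
    have hε : 0 < ε := hε
    rw [sub_self, add_zero, le_add_iff_nonneg_right]
    refine mul_nonneg hε.le ?_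
    split_ifs with hxY
    · have hlt : breakPoint a b Δ < b := lt_of_le_of_ne hx2 fun h => hbY (h ▸ hxY)
      have hR := one_le_ncard_exitsRight hY (a := a) (ha.trans hx1.le) hx1.le hlt le_rfl hb hxY hbY
      have hL := one_le_ncard_exitsLeft hY (b := b) ha le_rfl hx1 hx2 hb haY hxY
      linarith
    · linarith

theorem segmentBeta_nonneg (haY : X.pt e a ∈ Y) (hbY : X.pt e b ∈ Y) (Δ : ℝ) :
    0 ≤ segmentBeta Y e a b Δ := by
  have hR0 : (0 : ℝ) ≤ (X.exitsRight Y e ∩ Ico a b).ncard := Nat.cast_nonneg _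
  have hL0 : (0 : ℝ) ≤ (X.exitsLeft Y e ∩ Ioc a b).ncard := Nat.cast_nonneg _
  simp only [segmentBeta, haY, hbY, if_true]
  split_ifs <;> linarith

-- The point `y` outside `Y` forces an exit on either side of it, contributing at least `1` in
-- total, while the slope terms add up to `0` or `1`.
include hY ha hb in
theorem segmentBeta_pos (haY : X.pt e a ∈ Y) (hbY : X.pt e b ∈ Y) (Δ : ℝ) {y : ℝ}
    (hy : y ∈ Ioo a b) (hyY : X.pt e y ∉ Y) : 0 < segmentBeta Y e a b Δ := by
  have hR := one_le_ncard_exitsRight hY (a := a) ha le_rfl hy.1 hy.2.le hb haY hyY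
  have hL := one_le_ncard_exitsLeft hY (a := a) (ha.trans hy.1.le) hy.1.le hy.2 le_rfl hb hyY hbY
  simp only [segmentBeta, haY, hbY, if_true]
  split_ifs <;> linarith

end Segment

/-- Half-open pieces are disjoint, so an exit at a break point is assigned to only one segment. -/
theorem sum_ncard_inter_Ico_le {A : Set ℝ} (hA : A.Finite) {t : ℕ → ℝ} (ht : Monotone t) (n : ℕ) :
    ∑ i ∈ Finset.range n, (A ∩ Ico (t i) (t (i + 1))).ncard ≤ A.ncard := by
  have key : ∑ i ∈ Finset.range n, (A ∩ Ico (t i) (t (i + 1))).ncard ≤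
      (A ∩ Ico (t 0) (t n)).ncard := by
    induction n with
    | zero => simp
    | succ n ih =>
      rw [Finset.sum_range_succ, ← Ico_union_Ico_eq_Ico (ht (Nat.zero_le n)) (ht n.le_succ),
        inter_union_distrib_left, Set.ncard_union_eq _ (hA.inter_of_left _) (hA.inter_of_left _)]
      · exact add_le_add_left ih _
      · exact Set.disjoint_left.2 fun s hs hs' => absurd hs'.2.1 (not_le.2 hs.2.2)
  exact key.trans (Set.ncard_le_ncard inter_subset_left hA)

theorem sum_ncard_inter_Ioc_le {A : Set ℝ} (hA : A.Finite) {t : ℕ → ℝ} (ht : Monotone t) (n : ℕ) :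
    ∑ i ∈ Finset.range n, (A ∩ Ioc (t i) (t (i + 1))).ncard ≤ A.ncard := by
  have key : ∑ i ∈ Finset.range n, (A ∩ Ioc (t i) (t (i + 1))).ncard ≤
      (A ∩ Ioc (t 0) (t n)).ncard := by
    induction n with
    | zero => simp
    | succ n ih =>
      rw [Finset.sum_range_succ, ← Ioc_union_Ioc_eq_Ioc (ht (Nat.zero_le n)) (ht n.le_succ),
        inter_union_distrib_left, Set.ncard_union_eq _ (hA.inter_of_left _) (hA.inter_of_left _)]
      · exact add_le_add_left ih _
      · exact Set.disjoint_left.2 fun s hs hs' => absurd hs.2.2 (not_le.2 hs'.2.1)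
  exact key.trans (Set.ncard_le_ncard inter_subset_left hA)

/-! ### Subdivisions -/

/-- A subdivision of every edge of `X` into finitely many segments. -/
structure Subdivision (X : TropicalCurve.{u, v}) where
  /-- The number of segments of an edge. -/
  n : X.E → ℕ
  /-- The break points on an edge. -/
  t : X.E → ℕ → ℝ
  mono : ∀ e, Monotone (t e)
  zero : ∀ e, t e 0 = 0
  last : ∀ e, t e (n e) = X.len e
  lt : ∀ e, ∀ i < n e, t e i < t e (i + 1)

namespace Subdivision

variable (σ : X.Subdivision)

/-- The nodes of a subdivision: the vertices of `X` and the break points. -/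
def nodes : Set X.Point := range Point.vertex ∪ ⋃ e, (fun i => X.pt e (σ.t e i)) '' Iic (σ.n e)

/-- The segments of a subdivision. -/
abbrev Segment := Σ e : X.E, Fin (σ.n e)

/-- The initial parameter of a segment. -/
def left (k : σ.Segment) : ℝ := σ.t k.1 k.2

/-- The final parameter of a segment. -/
def right (k : σ.Segment) : ℝ := σ.t k.1 (k.2 + 1)

theorem finite_nodes : σ.nodes.Finite :=
  (Set.finite_range _).union (Set.finite_iUnion fun _ => (Set.finite_Iic _).image _)

theorem vertex_mem (w : X.V) : .vertex w ∈ σ.nodes := Or.inl ⟨w, rfl⟩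

theorem pt_mem (e : X.E) {i : ℕ} (hi : i ≤ σ.n e) : X.pt e (σ.t e i) ∈ σ.nodes :=
  Or.inr (mem_iUnion.2 ⟨e, i, hi, rfl⟩)

theorem pt_left_mem (k : σ.Segment) : X.pt k.1 (σ.left k) ∈ σ.nodes := σ.pt_mem k.1 k.2.2.le

theorem pt_right_mem (k : σ.Segment) : X.pt k.1 (σ.right k) ∈ σ.nodes := σ.pt_mem k.1 k.2.2

theorem left_nonneg (k : σ.Segment) : 0 ≤ σ.left k := (σ.zero k.1).ge.trans (σ.mono _ (Nat.zero_le _))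

theorem right_le (k : σ.Segment) : σ.right k ≤ X.len k.1 :=
  (σ.mono _ (Nat.succ_le_of_lt k.2.2)).trans (σ.last k.1).le

theorem left_lt_right (k : σ.Segment) : σ.left k < σ.right k := σ.lt k.1 k.2 k.2.2

theorem exists_mem_Ioo {p : X.Point} (hp : p ∉ σ.nodes) :
    ∃ k : σ.Segment, ∃ y ∈ Ioo (σ.left k) (σ.right k), X.pt k.1 y = p := by
  cases p with
  | vertex w => exact absurd (σ.vertex_mem w) hp
  | interior e y h h' =>
    obtain ⟨i, hi, hyi⟩ := exists_mem_Ico_subdivision (t := σ.t e) (n := σ.n e)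
      ((σ.zero e).trans_le h.le) (h'.trans_eq (σ.last e).symm)
    refine ⟨⟨e, i, hi⟩, y, ⟨lt_of_le_of_ne hyi.1 fun heq => hp ?_, hyi.2⟩, X.pt_of_mem_Ioo ⟨h, h'⟩⟩
    rw [← X.pt_of_mem_Ioo ⟨h, h'⟩, ← heq]
    exact σ.pt_mem e hi.le

theorem exists_subset_nodes (F : Finset X.Point) :
    ∃ σ : X.Subdivision, (F : Set X.Point) ⊆ σ.nodes := by
  have key : ∀ e : X.E, ∃ (n : ℕ) (t : ℕ → ℝ), Monotone t ∧ t 0 = 0 ∧ t n = X.len e ∧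
      (∀ i < n, t i < t (i + 1)) ∧
      ∀ τ ∈ Icc 0 (X.len e), X.pt e τ ∈ F → ∃ i ≤ n, t i = τ := by
    intro e
    have hfin : (⋃ p ∈ F, X.fiber p e).Finite :=
      F.finite_toSet.biUnion fun p _ => X.finite_fiber p e
    obtain ⟨n, t, h1, h2, h3, h4, h5⟩ := exists_subdivision hfin.toFinset (X.len_pos e)
    refine ⟨n, t, h1, h2, h3, h4, fun τ hτ hτF => h5 τ ?_ hτ⟩
    simp only [Finite.mem_toFinset, mem_iUnion, exists_prop]
    exact ⟨_, hτF, hτ, rfl⟩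
  choose n t h1 h2 h3 h4 h5 using key
  refine ⟨⟨n, t, h1, h2, h3, h4⟩, fun p hp => ?_⟩
  cases p with
  | vertex w => exact vertex_mem _ w
  | interior e y h h' =>
    have hy := X.pt_of_mem_Ioo ⟨h, h'⟩
    obtain ⟨i, hi, hiy⟩ := h5 e y ⟨h.le, h'.le⟩ (by rw [hy]; exact hp)
    rw [← hy, ← hiy]
    exact pt_mem ⟨n, t, h1, h2, h3, h4⟩ e hi

/-- The initial node of a segment. -/
noncomputable def leftNode (k : σ.Segment) : σ.nodes := ⟨X.pt k.1 (σ.left k), σ.pt_left_mem k⟩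

/-- The final node of a segment. -/
noncomputable def rightNode (k : σ.Segment) : σ.nodes := ⟨X.pt k.1 (σ.right k), σ.pt_right_mem k⟩

theorem eqvGen_nodes (p q : σ.nodes) :
    Relation.EqvGen (fun p q => ∃ k, σ.leftNode k = p ∧ σ.rightNode k = q) p q := by
  set r : σ.nodes → σ.nodes → Prop := fun p q => ∃ k, σ.leftNode k = p ∧ σ.rightNode k = q
  have hsrc : ∀ (e : X.E) (i : ℕ) (hi : i ≤ σ.n e),
      Relation.EqvGen r ⟨.vertex (X.src e), σ.vertex_mem _⟩ ⟨X.pt e (σ.t e i), σ.pt_mem e hi⟩ := by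
    intro e i hi
    induction i with
    | zero =>
      have : (⟨X.pt e (σ.t e 0), σ.pt_mem e hi⟩ : σ.nodes) =
          ⟨.vertex (X.src e), σ.vertex_mem _⟩ := Subtype.ext (by simp only [σ.zero, pt_zero])
      rw [this]
      exact .refl _
    | succ i ih => exact (ih (by omega)).trans _ _ _ (.rel _ _ ⟨⟨e, i, hi⟩, rfl, rfl⟩)
  have hV : ∀ w w' : X.V, Relation.EqvGen r ⟨.vertex w, σ.vertex_mem w⟩
      ⟨.vertex w', σ.vertex_mem w'⟩ := by
    intro w w'
    induction X.connected w w' with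
    | rel w w' h =>
      obtain ⟨e, rfl, rfl⟩ := h
      have h := hsrc e (σ.n e) le_rfl
      have heq : (⟨X.pt e (σ.t e (σ.n e)), σ.pt_mem e le_rfl⟩ : σ.nodes) =
          ⟨.vertex (X.tgt e), σ.vertex_mem _⟩ := Subtype.ext (by simp only [σ.last, pt_len])
      rwa [heq] at h
    | refl w => exact .refl _
    | symm _ _ _ ih => exact ih.symm
    | trans _ _ _ _ _ ih₁ ih₂ => exact ih₁.trans _ _ _ ih₂
  obtain ⟨w₀⟩ := X.nonempty
  have hbase : ∀ p : σ.nodes, Relation.EqvGen r ⟨.vertex w₀, σ.vertex_mem w₀⟩ p := by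
    rintro ⟨p, hp⟩
    rcases id hp with ⟨w, rfl⟩ | hp'
    · exact hV w₀ w
    · obtain ⟨e, i, hi, rfl⟩ := mem_iUnion.1 hp'
      exact (hV w₀ _).trans _ _ _ (hsrc e i hi)
  exact ((hbase p).symm).trans _ _ _ (hbase q)

/-! ### The divisor attached to a function on the nodes -/

variable (φ : X.Point → ℝ)

/-- The increment of `φ` along a segment. -/
noncomputable def incr (k : σ.Segment) : ℝ := φ (X.pt k.1 (σ.right k)) - φ (X.pt k.1 (σ.left k))

/-- The integral part of the slope of `φ` along a segment. -/
noncomputable def slope (k : σ.Segment) : ℤ := ⌊σ.incr φ k / (σ.right k - σ.left k)⌋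

/-- The parameter at which the integral extension of `φ` to a segment changes its slope. -/
noncomputable def mid (k : σ.Segment) : ℝ := breakPoint (σ.left k) (σ.right k) (σ.incr φ k)

/-- The divisor of the extension of `φ` from the nodes to a rational function which has, on every
segment, at most two slopes, which are consecutive integers in increasing order. -/
noncomputable def divisor : X.Divisor :=
  ∑ k : σ.Segment, (σ.slope φ k • (Finsupp.single (X.pt k.1 (σ.mid φ k)) 1 -
      Finsupp.single (X.pt k.1 (σ.left k)) 1) +
    (σ.slope φ k + 1) • (Finsupp.single (X.pt k.1 (σ.right k)) 1 -
      Finsupp.single (X.pt k.1 (σ.mid φ k)) 1))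

theorem isPrincipal_divisor : X.IsPrincipal (σ.divisor φ) := by
  classical
  have hmid : ∀ k, σ.mid φ k ∈ Ioc (σ.left k) (σ.right k) := fun k =>
    breakPoint_mem (σ.left_lt_right k) _
  -- Every segment carries two ramps, one before and one after its break point.
  have h := isPrincipal_of_slopes (X := X) (κ := σ.Segment ⊕ σ.Segment)
    (ed := Sum.elim Sigma.fst Sigma.fst) (a := Sum.elim σ.left (σ.mid φ))
    (b := Sum.elim (σ.mid φ) σ.right) (k := Sum.elim (σ.slope φ) fun k => σ.slope φ k + 1)
    (h := fun w => φ (.vertex w)) ?_ ?_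
  · rw [Fintype.sum_sum_type, ← Finset.sum_add_distrib] at h
    exact h
  · rintro (k | k)
    · exact ⟨σ.left_nonneg k, (hmid k).1.le, (hmid k).2.trans (σ.right_le k)⟩
    · exact ⟨(σ.left_nonneg k).trans (hmid k).1.le, (hmid k).2, σ.right_le k⟩
  · intro e
    -- The break point is the solution of this equation; summed over an edge, the increments
    -- telescope.
    have hk : ∀ k, (σ.slope φ k : ℝ) * (σ.mid φ k - σ.left k) +
        ((σ.slope φ k + 1 : ℤ) : ℝ) * (σ.right k - σ.mid φ k) = σ.incr φ k := by
      intro k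
      simp only [slope, mid, breakPoint]
      push_cast
      ring
    rw [Finset.sum_filter, Fintype.sum_sum_type, ← Finset.sum_add_distrib]
    simp only [Sum.elim_inl, Sum.elim_inr]
    have : ∀ k : σ.Segment, ((if k.1 = e then (σ.slope φ k : ℝ) * (σ.mid φ k - σ.left k) else 0) +
        if k.1 = e then ((σ.slope φ k + 1 : ℤ) : ℝ) * (σ.right k - σ.mid φ k) else 0) =
        if k.1 = e then σ.incr φ k else 0 := by
      intro k
      split_ifs
      · exact hk k
      · simp
    refine (Finset.sum_congr rfl fun k _ => this k).trans ?_
    rw [Fintype.sum_sigma, Finset.sum_eq_single e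
      (fun e' _ he' => by simp [he']) (by simp)]
    simp only [if_true, incr, left, right]
    rw [Fin.sum_univ_eq_sum_range
      (fun i => φ (X.pt e (σ.t e (i + 1))) - φ (X.pt e (σ.t e i))) (σ.n e),
      Finset.sum_range_sub (fun i => φ (X.pt e (σ.t e i))), σ.zero, σ.last, pt_zero, pt_len]

open Classical in
theorem degOn_divisor (Y : Set X.Point) : degOn Y (σ.divisor φ) = ∑ k : σ.Segment,
    (σ.slope φ k * ((if X.pt k.1 (σ.mid φ k) ∈ Y then 1 else 0) -
      if X.pt k.1 (σ.left k) ∈ Y then 1 else 0) +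
    (σ.slope φ k + 1) * ((if X.pt k.1 (σ.right k) ∈ Y then 1 else 0) -
      if X.pt k.1 (σ.mid φ k) ∈ Y then 1 else 0)) := by
  unfold divisor
  rw [map_sum]
  refine Finset.sum_congr rfl fun k _ => ?_
  rw [map_add, map_zsmul, map_zsmul, map_sub, map_sub, degOn_single, degOn_single, degOn_single]
  simp only [Set.indicator_apply, smul_eq_mul]

theorem deg_divisor : X.deg (σ.divisor φ) = 0 := by
  rw [deg_eq_degOn, degOn_divisor]
  simp

theorem sum_ncard_le_delta {Y : Set X.Point} (hY : X.IsSubcurve Y) :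
    ∑ k : σ.Segment, ((X.exitsRight Y k.1 ∩ Ico (σ.left k) (σ.right k)).ncard +
      (X.exitsLeft Y k.1 ∩ Ioc (σ.left k) (σ.right k)).ncard) ≤ X.delta Y := by
  rw [delta_eq, Fintype.sum_sigma]
  refine Finset.sum_le_sum fun e _ => ?_
  rw [Finset.sum_add_distrib]
  refine add_le_add ?_ ?_
  · refine le_trans (le_of_eq ?_) (sum_ncard_inter_Ico_le (hY.finite_exitsRight e) (σ.mono e) (σ.n e))
    exact Fin.sum_univ_eq_sum_range
      (fun i => (X.exitsRight Y e ∩ Ico (σ.t e i) (σ.t e (i + 1))).ncard) (σ.n e)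
  · refine le_trans (le_of_eq ?_) (sum_ncard_inter_Ioc_le (hY.finite_exitsLeft e) (σ.mono e) (σ.n e))
    exact Fin.sum_univ_eq_sum_range
      (fun i => (X.exitsLeft Y e ∩ Ioc (σ.t e i) (σ.t e (i + 1))).ncard) (σ.n e)

theorem sum_segmentBeta_le_beta (μ : X.Point →₀ ℝ) (D : X.Divisor) {Y : Set X.Point}
    (hY : X.IsSubcurve Y) :
    (degOn Y D : ℤ) - degOn Y μ +
      ∑ k : σ.Segment, segmentBeta Y k.1 (σ.left k) (σ.right k) (σ.incr φ k) ≤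
    X.beta μ (D + σ.divisor φ) Y := by
  classical
  have hδ : ((∑ k : σ.Segment, ((X.exitsRight Y k.1 ∩ Ico (σ.left k) (σ.right k)).ncard +
      (X.exitsLeft Y k.1 ∩ Ioc (σ.left k) (σ.right k)).ncard) : ℕ) : ℝ) ≤ X.delta Y := by
    exact_mod_cast σ.sum_ncard_le_delta hY
  rw [beta_eq, map_add, degOn_divisor]
  have hsplit : ∑ k : σ.Segment, segmentBeta Y k.1 (σ.left k) (σ.right k) (σ.incr φ k) =
      ((∑ k : σ.Segment, (σ.slope φ k * ((if X.pt k.1 (σ.mid φ k) ∈ Y then 1 else 0) -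
        if X.pt k.1 (σ.left k) ∈ Y then 1 else 0) +
      (σ.slope φ k + 1) * ((if X.pt k.1 (σ.right k) ∈ Y then 1 else 0) -
        if X.pt k.1 (σ.mid φ k) ∈ Y then 1 else 0)) : ℤ) : ℝ) +
      ((∑ k : σ.Segment, ((X.exitsRight Y k.1 ∩ Ico (σ.left k) (σ.right k)).ncard +
      (X.exitsLeft Y k.1 ∩ Ioc (σ.left k) (σ.right k)).ncard) : ℕ) : ℝ) / 2 := by
    push_cast
    rw [Finset.sum_div, ← Finset.sum_add_distrib]
    rfl
  rw [hsplit]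
  push_cast at hδ ⊢
  linarith

end Subdivision

/-! ### Existence of quasistable divisors -/

/-- The divisor is `D + div`, where `div` comes from the integral extension of an energy minimizer
on the nodes of an adapted subdivision. -/
theorem exists_isQuasistable (p₀ : X.Point) {d : ℤ} {μ : X.Point →₀ ℝ} (hμ : X.IsPolarization μ d)
    {D : X.Divisor} (hD : X.deg D = d) :
    ∃ D' : X.Divisor, X.deg D' = d ∧ X.Equivalent D' D ∧ X.IsQuasistable p₀ μ D' := by
  classical
  obtain ⟨σ, hσ⟩ := Subdivision.exists_subset_nodes (insert p₀ (D.support ∪ μ.support))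
  have := σ.finite_nodes.fintype
  have hp₀ : p₀ ∈ σ.nodes := hσ (by simp)
  have hsum : ∀ Y : Set X.Point, ((degOn Y D : ℤ) : ℝ) - degOn Y μ =
      ∑ p : σ.nodes, Y.indicator (fun p => (D p : ℝ) - μ p) p := by
    intro Y
    rw [degOn_eq_sum (F := σ.nodes.toFinset) (fun p hp => by
        rw [Set.mem_toFinset]; exact hσ (by simp at hp; simp [hp])),
      degOn_eq_sum (F := σ.nodes.toFinset) (fun p hp => by
        rw [Set.mem_toFinset]; exact hσ (by simp at hp; simp [hp])), Int.cast_sum,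
      ← Finset.sum_sub_distrib, ← Finset.sum_subtype σ.nodes.toFinset (by simp)
        (Y.indicator (fun p => (D p : ℝ) - μ p))]
    refine Finset.sum_congr rfl fun p _ => ?_
    by_cases hp : p ∈ Y <;> simp [hp]
  have hc : ∑ p : σ.nodes, ((D p : ℝ) - μ p) = 0 := by
    have h := hsum univ
    have h2 : degOn univ μ = (d : ℝ) := by
      rw [degOn_eq_sum subset_rfl]
      simpa [IsPolarization] using hμ
    rw [← deg_eq_degOn, hD, h2, sub_self] at h
    simpa using h.symm
  obtain ⟨φ, hφ⟩ := exists_energy_minimizer (a := σ.leftNode) (b := σ.rightNode)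
    (ℓ := fun k => σ.right k - σ.left k) (c := fun p : σ.nodes => (D p : ℝ) - μ p)
    (fun k => sub_pos.2 (σ.left_lt_right k)) hc ⟨p₀, hp₀⟩ (fun p => σ.eqvGen_nodes p _)
  -- The value `0` off the nodes is never read, since `incr` evaluates at nodes only.
  set Φ : X.Point → ℝ := fun p => if h : p ∈ σ.nodes then φ ⟨p, h⟩ else 0 with hΦ
  have hincr : ∀ k, φ (σ.rightNode k) - φ (σ.leftNode k) = σ.incr Φ k := by
    intro k
    simp only [Subdivision.incr, hΦ, σ.pt_left_mem, σ.pt_right_mem, dif_pos]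
    rfl
  have key : ∀ Y : Set X.Point, X.IsSubcurve Y → ∃ ε : ℝ, 0 < ε ∧
      energy σ.leftNode σ.rightNode (fun k => σ.right k - σ.left k)
        (fun p : σ.nodes => (D p : ℝ) - μ p)
        (fun p => φ p + (Subtype.val ⁻¹' Y : Set σ.nodes).indicator (fun _ => ε) p) ≤
      energy σ.leftNode σ.rightNode (fun k => σ.right k - σ.left k)
        (fun p : σ.nodes => (D p : ℝ) - μ p) φ + ε * X.beta μ (D + σ.divisor Φ) Y := by
    intro Y hY
    have hev := eventually_all.2 fun k : σ.Segment => squareInterp_le_segmentBeta hY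
      (σ.left_nonneg k) (σ.left_lt_right k) (σ.right_le k) (σ.incr Φ k)
    obtain ⟨ε, hε, hε0⟩ := (hev.and self_mem_nhdsWithin).exists
    have hε0 : 0 < ε := hε0
    refine ⟨ε, hε0, ?_⟩
    have hβ := mul_le_mul_of_nonneg_left (σ.sum_segmentBeta_le_beta Φ μ D hY) hε0.le
    rw [hsum, mul_add, Finset.mul_sum, Finset.mul_sum] at hβ
    have h1 := Finset.sum_le_sum fun (k : σ.Segment) (_ : k ∈ Finset.univ) => hε k
    rw [Finset.sum_add_distrib] at h1
    unfold energy
    have h2 : ∀ k, (φ (σ.rightNode k) +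
        (Subtype.val ⁻¹' Y : Set σ.nodes).indicator (fun _ => ε) (σ.rightNode k)) -
        (φ (σ.leftNode k) +
          (Subtype.val ⁻¹' Y : Set σ.nodes).indicator (fun _ => ε) (σ.leftNode k)) =
        σ.incr Φ k + ((if X.pt k.1 (σ.right k) ∈ Y then ε else 0) -
          if X.pt k.1 (σ.left k) ∈ Y then ε else 0) := by
      intro k
      rw [add_sub_add_comm, hincr]
      rfl
    have h3 : ∀ p : σ.nodes, ((D p : ℝ) - μ p) * (φ p +
        (Subtype.val ⁻¹' Y : Set σ.nodes).indicator (fun _ => ε) p) =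
        ((D p : ℝ) - μ p) * φ p + ε * Y.indicator (fun p => (D p : ℝ) - μ p) p := by
      intro p
      by_cases hp : (p : X.Point) ∈ Y
      · rw [Set.indicator_of_mem hp, Set.indicator_of_mem (by exact hp)]
        ring
      · rw [Set.indicator_of_notMem hp, Set.indicator_of_notMem (by exact hp)]
        ring
    simp only [h2, h3, hincr, Finset.sum_add_distrib]
    linarith
  refine ⟨D + σ.divisor Φ, ?_, ?_, fun Y hY => ?_, fun Y hY hYu hpY => ?_⟩
  · rw [deg_eq_degOn, map_add, ← deg_eq_degOn, ← deg_eq_degOn, σ.deg_divisor, hD, add_zero]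
  · rw [Equivalent, add_sub_cancel_left]
    exact σ.isPrincipal_divisor Φ
  · obtain ⟨ε, hε, hle⟩ := key Y hY
    have := (hφ (Subtype.val ⁻¹' Y) ε hε).1
    exact nonneg_of_mul_nonneg_right (by linarith) hε
  -- If `Y` contains all nodes, raising `φ` on `Y` adds a constant and the energy gives nothing. But
  -- then `D - μ` contributes `0` in total, and the segment with a point outside `Y` makes `β`
  -- positive.
  · by_cases hS : (Subtype.val ⁻¹' Y : Set σ.nodes) = univ
    · have hmem : ∀ p ∈ σ.nodes, p ∈ Y := fun p hp => by
        have : (⟨p, hp⟩ : σ.nodes) ∈ (Subtype.val ⁻¹' Y : Set σ.nodes) := hS ▸ mem_univ _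
        exact this
      refine lt_of_lt_of_le ?_ (σ.sum_segmentBeta_le_beta Φ μ D hY)
      have h0 : ∑ p : σ.nodes, Y.indicator (fun p => (D p : ℝ) - μ p) p = 0 := by
        rw [← hc]
        exact Finset.sum_congr rfl fun p _ => Set.indicator_of_mem (hmem p p.2) _
      rw [hsum, h0, zero_add]
      obtain ⟨q, hq⟩ := (Set.ne_univ_iff_exists_notMem Y).1 hYu
      obtain ⟨k, y, hy, rfl⟩ := σ.exists_mem_Ioo fun h => hq (hmem q h)
      exact Finset.sum_pos' (fun k _ => segmentBeta_nonneg (hmem _ (σ.pt_left_mem k))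
          (hmem _ (σ.pt_right_mem k)) _)
        ⟨k, Finset.mem_univ k, segmentBeta_pos hY (σ.left_nonneg k) (σ.right_le k)
          (hmem _ (σ.pt_left_mem k)) (hmem _ (σ.pt_right_mem k)) _ hy hq⟩
    · obtain ⟨ε, hε, hle⟩ := key Y hY
      have := (hφ (Subtype.val ⁻¹' Y) ε hε).2 hpY hS
      exact pos_of_mul_pos_right (by linarith) hε.le

end TropicalCurve

theorem mainTheorem1 (X : TropicalCurve.{u, v}) (p₀ : X.Point) (d : ℤ)
    (μ : X.Point →₀ ℝ) (hμ : X.IsPolarization μ d) (D : X.Divisor) (hD : X.deg D = d) :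
    ∃! D' : X.Divisor, X.deg D' = d ∧ X.Equivalent D' D ∧ X.IsQuasistable p₀ μ D' := by
  obtain ⟨D', hd, he, hq⟩ := TropicalCurve.exists_isQuasistable p₀ hμ hD
  refine ⟨D', ⟨hd, he, hq⟩, fun D'' ⟨hd', he', hq'⟩ =>
    hq'.eq_of_isPrincipal_sub hμ hd' hq ?_⟩
  have := he'.sub he
  rwa [sub_sub_sub_cancel_right] at this
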